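/- Consider $T$ rounds of online learning with $N\ge 1$ arms. In round $t$ the environment chooses, as a function of the history $\mathcal F_{t-1}$ (adaptive adversary), losses $\ell_{t,i}\in[0,1]$ and a weighted directed graph $G_t$ on the arms with weights $s_{t,(i,j)}\in[0,1]$, $s_{t,(i,i)}=1$. The learner plays an arm $I_t$, incurs $\ell_{t,I_t}$, and observes $G_t$ and the feedback $$c_{t,i}=s_{t,(I_t,i)}\,\ell_{t,i}+(1-s_{t,(I_t,i)})\,\xi_{t,i}\qquad(i=1,\dots,N),$$ where each $\xi_{t,i}$ has mean zero, satisfies $|\xi_{t,i}|\le R$ for a known constant $R>0$, and is independent of the history, of the arm $I_t$ and of all other noise terms. Exp3-WIX draws $I_t$, given $\mathcal F_{t-1}$, from the distribution $$p_{t,i}=\frac{\exp(-\eta_t\sum_{r<t}\hat\ell_{r,i})}{\sum_{j}\exp(-\eta_t\sum_{r<t}\hat\ell_{r,j})},\qquad \hat\ell_{t,i}=\frac{s_{t,(I_t,i)}\,c_{t,i}}{\sum_{j}p_{t,j}s_{t,(j,i)}^2+\gamma_t},$$ with $$\eta_t=\sqrt{\frac{\log N}{2(1+R+R^2)\bigl(N+\sum_{r<t}Q_r\bigr)}},\qquad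 \gamma_t=R\,\eta_t,\qquad Q_t=\sum_{i}\frac{p_{t,i}}{\sum_{j}p_{t,j}s_{t,(j,i)}^2+\gamma_t}.$$ (These choices use neither $T$ nor any independence number.) Let $\alpha^*_t=\min_{\varepsilon\in(0,1]}\alpha(G_t(\varepsilon))/\varepsilon^2$ be the effective independence number of $G_t$, where $G_t(\varepsilon)$ is the directed graph with an arc $i\to j$ whenever $s_{t,(i,j)}\ge\varepsilon$, and $\alpha$ is the largest size of a set of vertices with no arc between two distinct members. Then $$\max_{i}\mathbb E\Bigl[\sum_{t=1}^T\ell_{t,I_t}-\sum_{t=1}^T\ell_{t,i}\Bigr]=\widetilde{O}\Bigl((1+R)\,\mathbb E\sqrt{N+\textstyle\sum_{t=1}^T\alpha^*_t}\Bigr),$$ that is, there are universal constants $C$ and $k$ such that the left-hand side is at most $$C\,\bigl(\log(2+N+T+1/R)\bigr)^k\,(1+R)\;\mathbb E\sqrt{N+\textstyle\sum_{t=1}^T\alpha^*_t}$$ for all $N$, $T$, $R$ and all such environments. -/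

import Mathlib

open MeasureTheory ProbabilityTheory

noncomputable section

/-! Weighted observation graphs on the arms `Fin N`: `s i j` is the weight of the arc `i → j`. -/

/-- The unweighted directed graph `G(ε)`: the arc `i → j` is present iff `s i j ≥ ε`. -/
def thresholdGraph {N : ℕ} (s : Fin N → Fin N → ℝ) (ε : ℝ) : Digraph (Fin N) where
  Adj i j := ε ≤ s i j

/-- The independence number of a directed graph: the largest size of a set of vertices no two
distinct members of which are joined by an arc, in either direction. -/
def digraphIndepNum {N : ℕ} (G : Digraph (Fin N)) : ℕ :=
  G.toSimpleGraphInclusive.indepNum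

/-- The effective independence number `α* = min_{ε ∈ [0,1]} α(G(ε)) / ε²`. The value at `ε = 0`
is `+∞`, so that `ε` ranges over `(0,1]`. -/
def effectiveIndepNum {N : ℕ} (s : Fin N → Fin N → ℝ) : ℝ :=
  ⨅ ε : Set.Ioc (0 : ℝ) 1, (digraphIndepNum (thresholdGraph s ε) : ℝ) / (ε : ℝ) ^ 2

/-! The algorithm Exp3-WIX, for `N` arms and the noise bound `R`. -/

namespace Exp3WIX

/-- What the learner remembers between rounds: the cumulative loss estimates `L̂_{t-1,i}` and the
sum of the past `Q`'s. -/
structure State (N : ℕ) where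
  cumEst : Fin N → ℝ
  cumQ : ℝ

variable {N : ℕ}

/-- The learning rate. -/
def eta (R : ℝ) (σ : State N) : ℝ :=
  Real.sqrt (Real.log N / (2 * (1 + R + R ^ 2) * (N + σ.cumQ)))

/-- The implicit exploration parameter. -/
def gamma (R : ℝ) (σ : State N) : ℝ := R * eta R σ

/-- The probability with which the next arm is `i`. -/
def prob (R : ℝ) (σ : State N) (i : Fin N) : ℝ :=
  Real.exp (-(eta R σ) * σ.cumEst i) / ∑ j, Real.exp (-(eta R σ) * σ.cumEst j)

/-- The common denominator of the loss estimate of arm `i` and of the `i`-th term of `Q`. -/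
def denom (R : ℝ) (σ : State N) (s : Fin N → Fin N → ℝ) (i : Fin N) : ℝ :=
  (∑ j, prob R σ j * s j i ^ 2) + gamma R σ

/-- The quantity `Q` of the current round, in which the observation graph is `s`. -/
def Q (R : ℝ) (σ : State N) (s : Fin N → Fin N → ℝ) : ℝ :=
  ∑ i, prob R σ i / denom R σ s i

/-- The loss estimate of arm `i` when arm `a` was played, with observation graph `s` and
feedback `c`. -/
def lossEst (R : ℝ) (σ : State N) (s : Fin N → Fin N → ℝ) (a : Fin N) (c : Fin N → ℝ)
    (i : Fin N) : ℝ :=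
  s a i * c i / denom R σ s i

/-- The update at the end of a round. -/
def step (R : ℝ) (σ : State N) (s : Fin N → Fin N → ℝ) (a : Fin N) (c : Fin N → ℝ) : State N where
  cumEst i := σ.cumEst i + lossEst R σ s a c i
  cumQ := σ.cumQ + Q R σ s

/-- The state at the beginning of round `t` (rounds are numbered from `0`), as a function of the
observed graphs `s`, the arms played `a` and the feedback `c`; it uses only rounds before `t`. -/
def state (R : ℝ) (s : ℕ → Fin N → Fin N → ℝ) (a : ℕ → Fin N) (c : ℕ → Fin N → ℝ) :
    ℕ → State N
  | 0 => ⟨fun _ => 0, 0⟩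
  | t + 1 => step R (state R s a c t) (s t) (a t) (c t)

end Exp3WIX

/-! The protocol. Rounds are `t = 0, …, T - 1`, and `F t` is the information available just
before round `t`: the history of all earlier rounds, and possibly private randomness of the
environment. -/

/-- The feedback `c_{t,i}` in round `t`. -/
def feedback {Ω : Type*} {N : ℕ} (ℓ : ℕ → Ω → Fin N → ℝ) (s : ℕ → Ω → Fin N → Fin N → ℝ)
    (ξ : ℕ → Ω → Fin N → ℝ) (I : ℕ → Ω → Fin N) (t : ℕ) (ω : Ω) (i : Fin N) : ℝ :=
  s t ω (I t ω) i * ℓ t ω i + (1 - s t ω (I t ω) i) * ξ t ω i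

/-- `T` rounds of online learning with noisy side observations against an adaptive environment:
losses `ℓ t`, observation graphs `s t`, noise `ξ t`, played arms `I t`. -/
structure IsNoisyGame {Ω : Type*} {m : MeasurableSpace Ω} (P : Measure Ω) (F : Filtration ℕ m)
    {N : ℕ} (T : ℕ) (R : ℝ) (ℓ : ℕ → Ω → Fin N → ℝ) (s : ℕ → Ω → Fin N → Fin N → ℝ)
    (ξ : ℕ → Ω → Fin N → ℝ) (I : ℕ → Ω → Fin N) : Prop where
  /-- The losses are chosen on the basis of the history. -/
  loss_meas : ∀ t < T, ∀ i, Measurable[F t] fun ω => ℓ t ω i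
  loss_mem : ∀ t < T, ∀ ω i, ℓ t ω i ∈ Set.Icc (0 : ℝ) 1
  /-- The observation graph is chosen on the basis of the history. -/
  graph_meas : ∀ t < T, ∀ i j, Measurable[F t] fun ω => s t ω i j
  graph_mem : ∀ t < T, ∀ ω i j, s t ω i j ∈ Set.Icc (0 : ℝ) 1
  graph_self : ∀ t < T, ∀ ω i, s t ω i i = 1
  /-- The history contains the arms and the noise of all earlier rounds. -/
  arm_meas : ∀ t < T, Measurable[F (t + 1)] (I t)
  noise_meas : ∀ t < T, ∀ i, Measurable[F (t + 1)] fun ω => ξ t ω i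
  noise_mean : ∀ t < T, ∀ i, ∫ ω, ξ t ω i ∂P = 0
  noise_bound : ∀ t < T, ∀ i, ∀ᵐ ω ∂P, |ξ t ω i| ≤ R
  /-- Each noise term is independent of everything that happened before, of the arm played and
  of the other noise terms of the round. -/
  noise_indep : ∀ t < T, ∀ i,
    Indep (MeasurableSpace.comap (fun ω => ξ t ω i) inferInstance)
      (F t ⊔ MeasurableSpace.comap (I t) inferInstance ⊔
        ⨆ (j : Fin N) (_ : j ≠ i), MeasurableSpace.comap (fun ω => ξ t ω j) inferInstance) P

/-- The probability that Exp3-WIX gives to arm `i` in round `t`. -/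
def wixProb {Ω : Type*} {N : ℕ} (R : ℝ) (ℓ : ℕ → Ω → Fin N → ℝ)
    (s : ℕ → Ω → Fin N → Fin N → ℝ) (ξ : ℕ → Ω → Fin N → ℝ) (I : ℕ → Ω → Fin N)
    (t : ℕ) (ω : Ω) (i : Fin N) : ℝ :=
  Exp3WIX.prob R (Exp3WIX.state R (fun r => s r ω) (fun r => I r ω)
    (fun r => feedback ℓ s ξ I r ω) t) i

/-- The learner plays Exp3-WIX: given the history, `I t` is drawn from the distribution `p_t`. -/
def PlaysExp3WIX {Ω : Type*} {m : MeasurableSpace Ω} (P : Measure Ω) (F : Filtration ℕ m)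
    {N : ℕ} (T : ℕ) (R : ℝ) (ℓ : ℕ → Ω → Fin N → ℝ) (s : ℕ → Ω → Fin N → Fin N → ℝ)
    (ξ : ℕ → Ω → Fin N → ℝ) (I : ℕ → Ω → Fin N) : Prop :=
  ∀ t < T, ∀ i, P⟦I t ⁻¹' {i} | F t⟧ =ᵐ[P] fun ω => wixProb R ℓ s ξ I t ω i

/-- The expected regret `R_T`, against the best fixed arm. -/
def expectedRegret {Ω : Type*} {m : MeasurableSpace Ω} (P : Measure Ω) {N : ℕ} (T : ℕ)
    (ℓ : ℕ → Ω → Fin N → ℝ) (I : ℕ → Ω → Fin N) : ℝ :=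
  ⨆ i : Fin N, ∫ ω, (∑ t ∈ Finset.range T, ℓ t ω (I t ω) - ∑ t ∈ Finset.range T, ℓ t ω i) ∂P

end

/-!
# The regret of Exp3-WIX

Three facts give the bound.

*Exponential weights.* The implicit exploration `γ = R η` keeps every loss estimate above `-1/η`, so
that `exp (-x) ≤ 1 - x + x ^ 2` applies to `x = η ℓ̂`. The potential `(1/η) log ((1/N) ∑ exp (-η L))`
is monotone in `η`, so a decreasing learning rate does no harm, and along every sample path the
estimated regret is at most `log N / η_T` plus the second-order terms `η ∑ p ℓ̂ ^ 2`
(`Exp3WIX.estimated_regret_le`).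

*Expectations.* Given the history, the estimate of arm `i` has mean `ℓ (D - γ) / D` and second
moment at most `(1 + R ^ 2) / D`, where `D` is its denominator; the noise enters only through its
mean, its bound and its independence of the history and the arm. Hence the regret is at most the
expectation of `log N / η_T + (1 + R + R ^ 2) ∑ η Q` (`IsNoisyGame.integral_regret_le`), and the
choice of `η` together with `0 ≤ Q ≤ N` turns this into a multiple of
`(1 + R) √(log N) √(N + ∑ Q)` on each path (`Exp3WIX.log_div_eta_add_sum_le`). No Jensen inequality
is involved, so the expectation stays outside the square root.

*Graphs.* `Q ≤ 2 log (1 + 1/γ) α*` (`sum_div_sq_weight_le`). At a fixed threshold this is a weighted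
Turán-type bound: among any set of vertices of weight `W` one has in-weight at least `W / (2α)`, and
peeling off such vertices gives a telescoping sum of logarithms. Since `1/γ` is polynomial in
`2 + N + T + 1/R`, the factor is a constant times the logarithm in the statement, and the constants
`C = 12`, `k = 1` suffice. The right-hand side being a Bochner integral, `α*` also has to be shown
measurable, which is done by restricting the thresholds to rational numbers.
-/

/-! ### Independent sets and weighted in-neighbourhoods -/

section Graph

variable {V : Type*} [DecidableEq V]

/-- If every vertex of `U` has in-neighbourhood of weight at most `B` inside `U`, then `U` contains
an independent set with at least `w(U) / (2B)` vertices. The set is found greedily: double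
counting gives a vertex whose out-neighbourhood weighs no more than its in-neighbourhood, and
deleting it with all its neighbours costs weight at most `2B`. -/
lemma exists_indep_of_inWeight_le (r : V → V → Prop) [DecidableRel r] (hr : ∀ i, r i i)
    (w : V → ℝ) (hw : ∀ i, 0 < w i) (B : ℝ) (U : Finset V)
    (hB : ∀ i ∈ U, ∑ j ∈ U with r j i, w j ≤ B) :
    ∃ A ⊆ U, (∀ i ∈ A, ∀ j ∈ A, i ≠ j → ¬ r i j ∧ ¬ r j i) ∧ ∑ i ∈ U, w i ≤ A.card * (2 * B) := by
  induction U using Finset.strongInduction with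
  | H U ih =>
    rcases U.eq_empty_or_nonempty with rfl | hU
    · exact ⟨∅, by simp⟩
    obtain ⟨i, hi, hio⟩ : ∃ i ∈ U, w i * ∑ j ∈ U with r i j, w j ≤
        w i * ∑ j ∈ U with r j i, w j := by
      apply Finset.exists_le_of_sum_le hU
      apply le_of_eq
      simp_rw [Finset.mul_sum, Finset.sum_filter]
      rw [Finset.sum_comm]
      refine Finset.sum_congr rfl fun i _ => Finset.sum_congr rfl fun j _ => ?_
      split_ifs <;> ring
    have hio := le_of_mul_le_mul_left hio (hw i)
    set U' := U.filter fun j => ¬ (r i j ∨ r j i) with hU'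
    have hsub : U' ⊆ U := Finset.filter_subset _ _
    have hlt : U' ⊂ U := by
      refine Finset.ssubset_iff_subset_ne.2 ⟨hsub, fun h => ?_⟩
      rw [← h] at hi
      simp [hU', hr] at hi
    obtain ⟨A, hA, hind, hcard⟩ := ih U' hlt fun j hj =>
      (Finset.sum_le_sum_of_subset_of_nonneg (Finset.filter_subset_filter _ hsub)
        fun _ _ _ => (hw _).le).trans (hB j (hsub hj))
    have hAi : ∀ j ∈ A, ¬ r i j ∧ ¬ r j i := fun j hj => by
      have := (Finset.mem_filter.1 (hA hj)).2
      tauto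
    have hiA : i ∉ A := fun h => (hAi i h).1 (hr i)
    refine ⟨insert i A, Finset.insert_subset hi (hA.trans hsub), ?_, ?_⟩
    · intro a ha b hb hab
      rcases Finset.mem_insert.1 ha with rfl | ha' <;>
        rcases Finset.mem_insert.1 hb with rfl | hb'
      · exact absurd rfl hab
      · exact hAi b hb'
      · exact (hAi a ha').symm
      · exact hind a ha' b hb' hab
    · rw [Finset.card_insert_of_notMem hiA,
        ← Finset.sum_filter_add_sum_filter_not U fun j => r i j ∨ r j i]
      have h1 : ∑ j ∈ U with r i j ∨ r j i, w j ≤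
          ∑ j ∈ U with r i j, w j + ∑ j ∈ U with r j i, w j := by
        rw [Finset.filter_or, ← Finset.sum_union_inter]
        exact le_add_of_nonneg_right (Finset.sum_nonneg fun _ _ => (hw _).le)
      have h2 := hB i hi
      push_cast
      linarith

/-- The weighted form of `∑ 1 / (1 + indegree) ≤ 2 α log (1 + n / α)`. Peel off, one after the
other, the vertex of largest in-weight among the remaining vertices `U`: its in-weight is at least
`w(U) / (2α)`, so its term is at most `2α (log (γ + w(U)) - log (γ + w(U ∖ {i})))`, and these
bounds telescope. -/
lemma sum_div_inWeight_le (r : V → V → Prop) [DecidableRel r] (hr : ∀ i, r i i)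
    (w : V → ℝ) (hw : ∀ i, 0 < w i) (γ : ℝ) (hγ : 0 < γ) (α : ℕ) (hα : 1 ≤ α)
    (hind : ∀ A : Finset V, (∀ i ∈ A, ∀ j ∈ A, i ≠ j → ¬ r i j ∧ ¬ r j i) → A.card ≤ α)
    (U : Finset V) :
    ∑ i ∈ U, w i / (∑ j ∈ U with r j i, w j + γ) ≤
      2 * α * (Real.log (∑ i ∈ U, w i + γ) - Real.log γ) := by
  have hα' : (1 : ℝ) ≤ α := by exact_mod_cast hα
  induction U using Finset.strongInduction with
  | H U ih =>
    rcases U.eq_empty_or_nonempty with rfl | hU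
    · simp
    obtain ⟨i, hi, hmax⟩ := Finset.exists_max_image U (fun i => ∑ j ∈ U with r j i, w j) hU
    set B := ∑ j ∈ U with r j i, w j with hBdef
    have hB0 : 0 ≤ B := Finset.sum_nonneg fun _ _ => (hw _).le
    obtain ⟨A, -, hA, hAc⟩ := exists_indep_of_inWeight_le r hr w hw B U hmax
    have hAα : (A.card : ℝ) ≤ α := by exact_mod_cast hind A hA
    set W := ∑ i ∈ U, w i with hW
    have hWB : W ≤ α * (2 * B) := hAc.trans (by gcongr)
    have hrest := ih (U.erase i) (Finset.erase_ssubset hi)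
    have hWe : ∑ j ∈ U.erase i, w j = W - w i := by
      rw [hW, ← Finset.add_sum_erase U w hi]; ring
    rw [hWe] at hrest
    have hWi : 0 ≤ W - w i := hWe ▸ Finset.sum_nonneg fun _ _ => (hw _).le
    have hmono : ∑ k ∈ U.erase i, w k / (∑ j ∈ U with r j k, w j + γ) ≤
        ∑ k ∈ U.erase i, w k / (∑ j ∈ U.erase i with r j k, w j + γ) := by
      refine Finset.sum_le_sum fun k _ => ?_
      have h0 : 0 ≤ ∑ j ∈ U.erase i with r j k, w j := Finset.sum_nonneg fun _ _ => (hw _).le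
      have h1 : ∑ j ∈ U.erase i with r j k, w j ≤ ∑ j ∈ U with r j k, w j :=
        Finset.sum_le_sum_of_subset_of_nonneg
          (Finset.filter_subset_filter _ (Finset.erase_subset _ _)) fun _ _ _ => (hw _).le
      have := (hw k).le
      gcongr
    have hterm : w i / (B + γ) ≤ 2 * α * (Real.log (W + γ) - Real.log (W - w i + γ)) := by
      have hpos : 0 < W + γ := by linarith [hw i]
      have h1 : w i / (B + γ) ≤ 2 * α * (w i / (W + γ)) := by
        rw [← mul_div_assoc, div_le_div_iff₀ (by linarith) hpos]
        have : W + γ ≤ 2 * α * (B + γ) := by nlinarith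
        nlinarith [hw i]
      have h2 : w i / (W + γ) ≤ Real.log (W + γ) - Real.log (W - w i + γ) := by
        have h := Real.log_le_sub_one_of_pos (x := (W - w i + γ) / (W + γ)) (by positivity)
        rw [Real.log_div (by positivity) hpos.ne'] at h
        have : (W - w i + γ) / (W + γ) - 1 = - (w i / (W + γ)) := by field_simp; ring
        linarith
      exact h1.trans (by gcongr)
    rw [← Finset.add_sum_erase U _ hi]
    have e : 2 * (α : ℝ) * (Real.log (W + γ) - Real.log γ) =
      2 * α * (Real.log (W + γ) - Real.log (W - w i + γ)) +
      2 * α * (Real.log (W - w i + γ) - Real.log γ) := by ring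
    rw [e]
    exact add_le_add hterm (hmono.trans hrest)

end Graph

section IndepNum

variable {N : ℕ}

lemma card_le_digraphIndepNum (G : Digraph (Fin N)) (A : Finset (Fin N))
    (hA : ∀ i ∈ A, ∀ j ∈ A, i ≠ j → ¬ G.Adj i j ∧ ¬ G.Adj j i) : A.card ≤ digraphIndepNum G := by
  refine SimpleGraph.IsIndepSet.card_le_indepNum ?_
  intro i hi j hj hij h
  have := hA i hi j hj hij
  simp [Digraph.toSimpleGraphInclusive, SimpleGraph.fromRel_adj] at h
  tauto

lemma one_le_digraphIndepNum (hN : 0 < N) (G : Digraph (Fin N)) : 1 ≤ digraphIndepNum G := by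
  have := card_le_digraphIndepNum G {⟨0, hN⟩} (by simp)
  simpa using this

lemma digraphIndepNum_le (G : Digraph (Fin N)) : digraphIndepNum G ≤ N := by
  obtain ⟨A, hA⟩ := G.toSimpleGraphInclusive.exists_isNIndepSet_indepNum
  rw [digraphIndepNum, ← hA.card_eq]
  simpa using A.card_le_univ

instance nonempty_Ioc_zero_one : Nonempty (Set.Ioc (0 : ℝ) 1) := ⟨⟨1, by simp⟩⟩

lemma bddBelow_effectiveIndepNum (s : Fin N → Fin N → ℝ) :
    BddBelow (Set.range fun ε : Set.Ioc (0 : ℝ) 1 =>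
      (digraphIndepNum (thresholdGraph s ε) : ℝ) / (ε : ℝ) ^ 2) :=
  ⟨0, by rintro _ ⟨ε, rfl⟩; positivity⟩

lemma effectiveIndepNum_nonneg (s : Fin N → Fin N → ℝ) : 0 ≤ effectiveIndepNum s :=
  le_ciInf fun _ => by positivity

lemma effectiveIndepNum_le (s : Fin N → Fin N → ℝ) : effectiveIndepNum s ≤ N := by
  refine (ciInf_le (bddBelow_effectiveIndepNum s) ⟨1, by simp⟩).trans ?_
  simpa using digraphIndepNum_le _

/-- The deterministic bound on `Q`: at every threshold `ε`, the squared weights dominate `ε²` times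
the arcs of `G(ε)`. -/
lemma sum_div_sq_weight_le (hN : 0 < N) (s : Fin N → Fin N → ℝ)
    (hs1 : ∀ i, s i i = 1) (p : Fin N → ℝ) (hp : ∀ i, 0 < p i)
    (hp1 : ∑ i, p i = 1) (γ : ℝ) (hγ : 0 < γ) :
    ∑ i, p i / (∑ j, p j * s j i ^ 2 + γ) ≤
      2 * Real.log (1 + 1 / γ) * effectiveIndepNum s := by
  have hlog : 0 < Real.log (1 + 1 / γ) := Real.log_pos (by simp [hγ])
  rw [← div_le_iff₀' (by positivity)]
  refine le_ciInf fun ⟨ε, hε0, hε1⟩ => ?_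
  rw [div_le_iff₀' (by positivity)]
  classical
  have hα := one_le_digraphIndepNum hN (thresholdGraph s ε)
  have key := sum_div_inWeight_le (fun i j => ε ≤ s i j) (fun i => by simp [hs1, hε1]) p hp γ hγ
    (digraphIndepNum (thresholdGraph s ε)) hα
    (fun A hA => card_le_digraphIndepNum (thresholdGraph s ε) A hA) Finset.univ
  have hl : Real.log (∑ i, p i + γ) - Real.log γ = Real.log (1 + 1 / γ) := by
    rw [hp1, ← Real.log_div (by positivity) hγ.ne']
    congr 1
    field_simp
    ring
  rw [hl] at key
  have : ∑ i, p i / (∑ j, p j * s j i ^ 2 + γ) ≤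
      ∑ i, (p i / (∑ j with ε ≤ s j i, p j + γ)) / ε ^ 2 := by
    refine Finset.sum_le_sum fun i _ => ?_
    rw [div_div]
    have h0 : 0 ≤ ∑ j with ε ≤ s j i, p j := Finset.sum_nonneg fun _ _ => (hp _).le
    refine div_le_div_of_nonneg_left (hp i).le (by positivity) ?_
    rw [add_mul, Finset.sum_mul]
    refine add_le_add ?_ (mul_le_of_le_one_right hγ.le (pow_le_one₀ hε0.le hε1))
    rw [Finset.sum_filter]
    refine Finset.sum_le_sum fun j _ => ?_
    have := (hp j).le
    split_ifs with h
    · gcongr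
    · positivity
  refine this.trans ?_
  rw [← Finset.sum_div, div_le_iff₀ (by positivity)]
  refine key.trans (le_of_eq ?_)
  field_simp

/-- Thresholds may be restricted to rational numbers, since `G(ε)` does not change when `ε` is
lowered by a small amount. -/
lemma effectiveIndepNum_eq_iInf_rat (s : Fin N → Fin N → ℝ) :
    effectiveIndepNum s = ⨅ q : {q : ℚ // 0 < q ∧ q ≤ 1},
      (digraphIndepNum (thresholdGraph s (q : ℚ)) : ℝ) / ((q : ℚ) : ℝ) ^ 2 := by
  have hne : Nonempty {q : ℚ // 0 < q ∧ q ≤ 1} := ⟨⟨1, by norm_num⟩⟩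
  apply le_antisymm
  · refine le_ciInf fun ⟨q, hq0, hq1⟩ => ?_
    exact ciInf_le (bddBelow_effectiveIndepNum s) ⟨q, by exact_mod_cast hq0, by exact_mod_cast hq1⟩
  · refine le_ciInf fun ⟨ε, hε0, hε1⟩ => ?_
    have hgraph : ∀ᶠ x in nhdsWithin ε (Set.Iio ε), thresholdGraph s x = thresholdGraph s ε := by
      have : ∀ᶠ x in nhdsWithin ε (Set.Iio ε), ∀ i j, x ≤ s i j ↔ ε ≤ s i j := by
        rw [Filter.eventually_all]; intro i
        rw [Filter.eventually_all]; intro j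
        by_cases h : ε ≤ s i j
        · filter_upwards [self_mem_nhdsWithin] with x hx
          exact ⟨fun _ => h, fun _ => (le_of_lt hx).trans h⟩
        · filter_upwards [mem_nhdsWithin_of_mem_nhds (Ioi_mem_nhds (not_le.1 h))] with x hx
          exact ⟨fun h' => absurd h' (not_le.2 hx), fun h' => absurd h' h⟩
      filter_upwards [this] with x hx
      ext i j
      exact hx i j
    refine le_of_forall_pos_le_add fun δ hδ => ?_
    have hcont : Filter.Tendsto
        (fun x : ℝ => (digraphIndepNum (thresholdGraph s ε) : ℝ) / x ^ 2)
        (nhdsWithin ε (Set.Iio ε)) (nhds ((digraphIndepNum (thresholdGraph s ε) : ℝ) / ε ^ 2)) := by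
      refine Filter.Tendsto.mono_left ?_ nhdsWithin_le_nhds
      exact ContinuousAt.div continuousAt_const (by fun_prop) (by positivity)
    have hlt := hcont.eventually (gt_mem_nhds (lt_add_of_pos_right _ hδ))
    have hpos : ∀ᶠ x in nhdsWithin ε (Set.Iio ε), 0 < x :=
      mem_nhdsWithin_of_mem_nhds (Ioi_mem_nhds hε0)
    obtain ⟨l, hl, hl'⟩ := (mem_nhdsLT_iff_exists_Ioo_subset' hε0).1 (hgraph.and (hlt.and hpos))
    obtain ⟨q, hq1, hq2⟩ := exists_rat_btwn (Set.mem_Iio.1 hl)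
    obtain ⟨h1, h2, h3⟩ := hl' ⟨hq1, hq2⟩
    refine (ciInf_le ⟨0, by rintro _ ⟨q, rfl⟩; positivity⟩
      ⟨q, by exact_mod_cast h3, by exact_mod_cast (hq2.le.trans hε1)⟩).trans ?_
    simp only
    rw [h1]
    exact h2.le

lemma measurable_effectiveIndepNum {Ω : Type*} {mΩ : MeasurableSpace Ω}
    {s : Ω → Fin N → Fin N → ℝ} (hs : ∀ i j, Measurable fun ω => s ω i j) :
    Measurable fun ω => effectiveIndepNum (s ω) := by
  simp_rw [effectiveIndepNum_eq_iInf_rat]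
  refine Measurable.iInf fun q => Measurable.div_const ?_ _
  have h1 : Measurable fun ω => fun i j => ((q : ℚ) : ℝ) ≤ s ω i j := by
    refine measurable_pi_lambda _ fun i => measurable_pi_lambda _ fun j => ?_
    exact measurableSet_setOfPred.1 (measurableSet_le measurable_const (hs i j))
  have h2 : Measurable fun A : Fin N → Fin N → Prop => (digraphIndepNum ⟨A⟩ : ℝ) :=
    measurable_of_finite _
  exact h2.comp h1

end IndepNum

/-! ### Exponential weights with a decreasing learning rate -/

section ExpWeights

variable {N : ℕ}

/-- The log-partition potential `(1/η) log ((1/N) ∑ᵢ exp (-η Lᵢ))` of exponential weights. -/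
noncomputable def wixPotential (η : ℝ) (L : Fin N → ℝ) : ℝ :=
  Real.log (∑ i, (N : ℝ)⁻¹ * Real.exp (-η * L i)) / η

lemma wixPotential_zero (hN : 0 < N) (η : ℝ) : wixPotential η (fun _ : Fin N => 0) = 0 := by
  have : (N : ℝ) ≠ 0 := by positivity
  simp [wixPotential, this]

/-- Power means increase with the exponent. -/
lemma wixPotential_mono (hN : 0 < N) {η η' : ℝ} (hη : 0 < η') (h : η' ≤ η) (L : Fin N → ℝ) :
    wixPotential η' L ≤ wixPotential η L := by
  have hη' : 0 < η := hη.trans_le h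
  have : Nonempty (Fin N) := ⟨⟨0, hN⟩⟩
  have hNr : (0 : ℝ) < N := by exact_mod_cast hN
  have key := Real.rpow_arith_mean_le_arith_mean_rpow Finset.univ (fun _ : Fin N => (N : ℝ)⁻¹)
    (fun i => Real.exp (-η' * L i)) (fun _ _ => by positivity) (by simp [hNr.ne'])
    (fun _ _ => (Real.exp_pos _).le) (p := η / η') ((one_le_div hη).2 h)
  have hpos : ∀ x, 0 < ∑ i, (N : ℝ)⁻¹ * Real.exp (-x * L i) := fun x =>
    Finset.sum_pos (fun _ _ => by positivity) Finset.univ_nonempty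
  have e : ∀ i, Real.exp (-η' * L i) ^ (η / η') = Real.exp (-η * L i) := fun i => by
    rw [← Real.exp_mul]; congr 1; field_simp
  simp_rw [e] at key
  have := Real.log_le_log (Real.rpow_pos_of_pos (hpos η') _) key
  rw [Real.log_rpow (hpos η')] at this
  unfold wixPotential
  rw [div_le_div_iff₀ hη hη']
  rw [div_mul_eq_mul_div, div_le_iff₀ hη] at this
  linarith

lemma neg_le_wixPotential (hN : 0 < N) {η : ℝ} (hη : 0 < η) (L : Fin N → ℝ) (k : Fin N) :
    -L k - Real.log N / η ≤ wixPotential η L := by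
  have hNr : (0 : ℝ) < N := by exact_mod_cast hN
  unfold wixPotential
  rw [le_div_iff₀ hη]
  have h1 : (N : ℝ)⁻¹ * Real.exp (-η * L k) ≤ ∑ i, (N : ℝ)⁻¹ * Real.exp (-η * L i) :=
    Finset.single_le_sum (f := fun i => (N : ℝ)⁻¹ * Real.exp (-η * L i))
      (fun _ _ => by positivity) (Finset.mem_univ k)
  have h2 := Real.log_le_log (by positivity) h1
  rw [Real.log_mul (by positivity) (by positivity), Real.log_exp, Real.log_inv] at h2
  have : (-L k - Real.log N / η) * η = -Real.log N + -η * L k := by field_simp; ring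
  linarith

lemma exp_le_one_add_add_sq {y : ℝ} (hy : y ≤ 1) : Real.exp y ≤ 1 + y + y ^ 2 := by
  rcases le_or_gt (-1) y with h | h
  · have := Real.abs_exp_sub_one_sub_id_le (abs_le.2 ⟨h, hy⟩)
    linarith [(abs_le.1 this).2]
  · have := Real.exp_le_one_iff.2 (by linarith : y ≤ 0)
    nlinarith

/-- One round of exponential weights; the estimates `h` may be negative, but not too much. -/
lemma wixPotential_add_le (hN : 0 < N) {η : ℝ} (hη : 0 < η) (L h : Fin N → ℝ)
    (hh : ∀ i, -1 ≤ η * h i) (p : Fin N → ℝ)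
    (hp : ∀ i, p i = Real.exp (-η * L i) / ∑ j, Real.exp (-η * L j)) :
    wixPotential η (fun i => L i + h i) ≤
      wixPotential η L - ∑ i, p i * h i + η * ∑ i, p i * h i ^ 2 := by
  have hne : Nonempty (Fin N) := ⟨⟨0, hN⟩⟩
  have hNr : (0 : ℝ) < N := by exact_mod_cast hN
  set Z := ∑ j, Real.exp (-η * L j) with hZ
  have hZ0 : 0 < Z := Finset.sum_pos (fun _ _ => Real.exp_pos _) Finset.univ_nonempty
  have hpe : ∀ i, Real.exp (-η * L i) = Z * p i := fun i => by
    rw [hp, mul_div_cancel₀ _ hZ0.ne']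
  have hp0 : ∀ i, 0 ≤ p i := fun i => by
    rw [hp]; exact div_nonneg (Real.exp_pos _).le hZ0.le
  have hNZ : 0 < (N : ℝ)⁻¹ * Z := mul_pos (inv_pos.2 hNr) hZ0
  have hp1 : ∑ i, p i = 1 := by simp_rw [hp]; rw [← Finset.sum_div]; exact div_self hZ0.ne'
  have h1 : ∑ i, (N : ℝ)⁻¹ * Real.exp (-η * (L i + h i)) ≤
      ((N : ℝ)⁻¹ * Z) * (1 + (-η * ∑ i, p i * h i + η ^ 2 * ∑ i, p i * h i ^ 2)) := by
    have e : (N : ℝ)⁻¹ * Z * (1 + (-η * ∑ i, p i * h i + η ^ 2 * ∑ i, p i * h i ^ 2)) =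
        ∑ i, (N : ℝ)⁻¹ * Z * (p i + (-η * (p i * h i) + η ^ 2 * (p i * h i ^ 2))) := by
      rw [← Finset.mul_sum, Finset.sum_add_distrib, Finset.sum_add_distrib, ← Finset.mul_sum,
        ← Finset.mul_sum, hp1]
    rw [e]
    refine Finset.sum_le_sum fun i _ => ?_
    rw [mul_add, Real.exp_add, hpe]
    have := exp_le_one_add_add_sq (y := -η * h i) (by linarith [hh i])
    have h3 : 0 ≤ (N : ℝ)⁻¹ * Z * p i := mul_nonneg hNZ.le (hp0 i)
    nlinarith [mul_le_mul_of_nonneg_left this h3]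
  have h0 : 0 < ∑ i, (N : ℝ)⁻¹ * Real.exp (-η * (L i + h i)) :=
    Finset.sum_pos (fun _ _ => mul_pos (inv_pos.2 hNr) (Real.exp_pos _)) Finset.univ_nonempty
  have hpos : 0 < 1 + (-η * ∑ i, p i * h i + η ^ 2 * ∑ i, p i * h i ^ 2) := by
    refine pos_of_mul_pos_right (h0.trans_le h1) hNZ.le
  have h2 := Real.log_le_log h0 h1
  rw [Real.log_mul hNZ.ne' hpos.ne'] at h2
  have h3 := Real.log_le_sub_one_of_pos hpos
  unfold wixPotential
  rw [div_le_iff₀ hη, ← Finset.mul_sum Finset.univ (fun i => Real.exp (-η * L i)), ← hZ]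
  have : (Real.log ((N : ℝ)⁻¹ * Z) / η - ∑ i, p i * h i + η * ∑ i, p i * h i ^ 2) * η =
    Real.log ((N : ℝ)⁻¹ * Z) - η * ∑ i, p i * h i + η ^ 2 * ∑ i, p i * h i ^ 2 := by
    field_simp
  rw [this]
  linarith

end ExpWeights

/-! ### Exp3-WIX along one sample path -/

namespace Exp3WIX

variable {N : ℕ} {R : ℝ}

lemma prob_pos (hN : 0 < N) (σ : State N) (i : Fin N) : 0 < prob R σ i := by
  have hne : Nonempty (Fin N) := ⟨⟨0, hN⟩⟩
  exact div_pos (Real.exp_pos _)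
    (Finset.sum_pos (fun _ _ => Real.exp_pos _) Finset.univ_nonempty)

lemma sum_prob (hN : 0 < N) (σ : State N) : ∑ i, prob R σ i = 1 := by
  have hne : Nonempty (Fin N) := ⟨⟨0, hN⟩⟩
  unfold prob
  rw [← Finset.sum_div]
  exact div_self (Finset.sum_pos (fun _ _ => Real.exp_pos _) Finset.univ_nonempty).ne'

lemma prob_le_one (hN : 0 < N) (σ : State N) (i : Fin N) : prob R σ i ≤ 1 := by
  rw [← sum_prob (R := R) hN σ]
  exact Finset.single_le_sum (f := prob R σ) (fun _ _ => (prob_pos hN σ _).le) (Finset.mem_univ i)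

lemma log_natCast_pos (hN : 2 ≤ N) : 0 < Real.log N := Real.log_pos (by exact_mod_cast hN)

lemma eta_pos (hR : 0 < R) (hN : 2 ≤ N) {σ : State N} (hσ : 0 ≤ σ.cumQ) : 0 < eta R σ := by
  have h1 := log_natCast_pos hN
  have : (0 : ℝ) < N := by positivity
  exact Real.sqrt_pos.2 (by positivity)

lemma eta_anti (hR : 0 < R) (hN : 2 ≤ N) {σ τ : State N} (hσ : 0 ≤ σ.cumQ)
    (h : σ.cumQ ≤ τ.cumQ) : eta R τ ≤ eta R σ := by
  have h1 := log_natCast_pos hN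
  have : (0 : ℝ) < N := by positivity
  unfold eta
  gcongr

lemma gamma_pos (hR : 0 < R) (hN : 2 ≤ N) {σ : State N} (hσ : 0 ≤ σ.cumQ) : 0 < gamma R σ :=
  mul_pos hR (eta_pos hR hN hσ)

lemma gamma_le_denom (hN : 0 < N) (σ : State N) (s : Fin N → Fin N → ℝ) (i : Fin N) :
    gamma R σ ≤ denom R σ s i :=
  le_add_of_nonneg_left (Finset.sum_nonneg fun j _ => mul_nonneg (prob_pos hN σ j).le (sq_nonneg _))

lemma prob_le_denom (hR : 0 < R) (hN : 2 ≤ N) {σ : State N} (hσ : 0 ≤ σ.cumQ)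
    {s : Fin N → Fin N → ℝ} (hs : ∀ i, s i i = 1) (i : Fin N) : prob R σ i ≤ denom R σ s i := by
  have h : prob R σ i * s i i ^ 2 ≤ ∑ j, prob R σ j * s j i ^ 2 :=
    Finset.single_le_sum (f := fun j => prob R σ j * s j i ^ 2)
      (fun j _ => mul_nonneg (prob_pos (by omega) σ j).le (sq_nonneg _)) (Finset.mem_univ i)
  rw [hs] at h
  unfold denom
  linarith [gamma_pos hR hN hσ]

lemma denom_pos (hR : 0 < R) (hN : 2 ≤ N) {σ : State N} (hσ : 0 ≤ σ.cumQ)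
    (s : Fin N → Fin N → ℝ) (i : Fin N) : 0 < denom R σ s i :=
  (gamma_pos hR hN hσ).trans_le (gamma_le_denom (by omega) σ s i)

lemma Q_nonneg (hR : 0 < R) (hN : 2 ≤ N) {σ : State N} (hσ : 0 ≤ σ.cumQ)
    (s : Fin N → Fin N → ℝ) : 0 ≤ Q R σ s :=
  Finset.sum_nonneg fun i _ => div_nonneg (prob_pos (by omega) σ i).le (denom_pos hR hN hσ s i).le

lemma Q_le (hR : 0 < R) (hN : 2 ≤ N) {σ : State N} (hσ : 0 ≤ σ.cumQ)
    {s : Fin N → Fin N → ℝ} (hs : ∀ i, s i i = 1) : Q R σ s ≤ N := by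
  refine (Finset.sum_le_card_nsmul Finset.univ _ 1 fun i _ => ?_).trans (by simp)
  exact div_le_one_of_le₀ (prob_le_denom hR hN hσ hs i) (denom_pos hR hN hσ s i).le

/-- The implicit exploration keeps the estimates from being very negative. -/
lemma neg_one_le_eta_mul_lossEst (hR : 0 < R) (hN : 2 ≤ N) {σ : State N} (hσ : 0 ≤ σ.cumQ)
    {s : Fin N → Fin N → ℝ} {a : Fin N} {c : Fin N → ℝ} {i : Fin N}
    (hc : -R ≤ s a i * c i) : -1 ≤ eta R σ * lossEst R σ s a c i := by
  have hD := denom_pos hR hN hσ s i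
  have hη := eta_pos hR hN hσ
  have h1 := gamma_le_denom (R := R) (by omega) σ s i
  unfold gamma at h1
  unfold lossEst
  rw [← mul_div_assoc, le_div_iff₀ hD]
  nlinarith

lemma state_cumEst (s : ℕ → Fin N → Fin N → ℝ) (a : ℕ → Fin N) (c : ℕ → Fin N → ℝ) (t : ℕ)
    (k : Fin N) : (state R s a c t).cumEst k =
      ∑ r ∈ Finset.range t, lossEst R (state R s a c r) (s r) (a r) (c r) k := by
  induction t with
  | zero => rfl
  | succ t ih => rw [Finset.sum_range_succ, ← ih]; rfl

lemma state_cumQ_nonneg (hR : 0 < R) (hN : 2 ≤ N) (s : ℕ → Fin N → Fin N → ℝ) (a : ℕ → Fin N)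
    (c : ℕ → Fin N → ℝ) (t : ℕ) : 0 ≤ (state R s a c t).cumQ := by
  induction t with
  | zero => exact le_rfl
  | succ t ih => exact add_nonneg ih (Q_nonneg hR hN ih _)

lemma state_cumQ_le (hR : 0 < R) (hN : 2 ≤ N) (s : ℕ → Fin N → Fin N → ℝ) (a : ℕ → Fin N)
    (c : ℕ → Fin N → ℝ) (t : ℕ) (hs : ∀ r < t, ∀ i, s r i i = 1) :
    (state R s a c t).cumQ ≤ t * N := by
  induction t with
  | zero => simp [state]
  | succ t ih =>
    have h1 := ih fun r hr => hs r (by omega)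
    have h2 := Q_le hR hN (state_cumQ_nonneg hR hN s a c t) (hs t (by omega))
    have : (state R s a c (t + 1)).cumQ =
      (state R s a c t).cumQ + Q R (state R s a c t) (s t) := rfl
    push_cast
    linarith

/-- The regret of exponential weights with respect to the estimated losses. -/
lemma estimated_regret_le (hR : 0 < R) (hN : 2 ≤ N) (s : ℕ → Fin N → Fin N → ℝ) (a : ℕ → Fin N)
    (c : ℕ → Fin N → ℝ) (T : ℕ) (hc : ∀ t < T, ∀ i, -R ≤ s t (a t) i * c t i) (k : Fin N) :
    ∑ t ∈ Finset.range T,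
      (∑ i, prob R (state R s a c t) i * lossEst R (state R s a c t) (s t) (a t) (c t) i
        - lossEst R (state R s a c t) (s t) (a t) (c t) k
        - eta R (state R s a c t) * ∑ i, prob R (state R s a c t) i *
            lossEst R (state R s a c t) (s t) (a t) (c t) i ^ 2) ≤
      Real.log N / eta R (state R s a c T) := by
  have hσ := state_cumQ_nonneg hR hN s a c
  have main : ∀ n ≤ T, wixPotential (eta R (state R s a c n)) (state R s a c n).cumEst ≤
      - ∑ t ∈ Finset.range n,
      (∑ i, prob R (state R s a c t) i * lossEst R (state R s a c t) (s t) (a t) (c t) i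
        - eta R (state R s a c t) * ∑ i, prob R (state R s a c t) i *
            lossEst R (state R s a c t) (s t) (a t) (c t) i ^ 2) := by
    intro n hn
    induction n with
    | zero =>
      rw [Finset.range_zero, Finset.sum_empty, neg_zero]
      exact (wixPotential_zero (by omega) _).le
    | succ n ih =>
      have ih := ih (by omega)
      have h1 := wixPotential_mono (by omega) (eta_pos hR hN (hσ (n + 1)))
        (eta_anti hR hN (hσ n) (le_add_of_nonneg_right (Q_nonneg hR hN (hσ n) (s n))) :
          eta R (state R s a c (n + 1)) ≤ eta R (state R s a c n))
        (state R s a c (n + 1)).cumEst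
      have h2 := wixPotential_add_le (by omega) (eta_pos hR hN (hσ n)) (state R s a c n).cumEst
        (lossEst R (state R s a c n) (s n) (a n) (c n))
        (fun i => neg_one_le_eta_mul_lossEst hR hN (hσ n) (hc n (by omega) i))
        (prob R (state R s a c n)) (fun _ => rfl)
      have h3 : (state R s a c (n + 1)).cumEst = fun i => (state R s a c n).cumEst i +
        lossEst R (state R s a c n) (s n) (a n) (c n) i := rfl
      rw [← h3] at h2
      rw [Finset.sum_range_succ]
      linarith
  have h1 := main T le_rfl
  have h2 := neg_le_wixPotential (by omega) (eta_pos hR hN (hσ T)) (state R s a c T).cumEst k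
  rw [state_cumEst] at h2
  simp only [Finset.sum_sub_distrib] at h1 ⊢
  linarith

lemma div_sqrt_le {x q : ℝ} (hx : 0 < x) (hq : 0 ≤ q) (hqx : q ≤ x) :
    q / Real.sqrt x ≤ 3 * (Real.sqrt (x + q) - Real.sqrt x) := by
  have h0 : 0 < Real.sqrt x := Real.sqrt_pos.2 hx
  have h1 := Real.sq_sqrt hx.le
  have h2 := Real.sq_sqrt (by linarith : 0 ≤ x + q)
  have h3 : Real.sqrt x ≤ Real.sqrt (x + q) := Real.sqrt_le_sqrt (by linarith)
  have h4 : Real.sqrt (x + q) ≤ 2 * Real.sqrt x := by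
    apply Real.sqrt_le_iff.2 ⟨by positivity, by nlinarith⟩
  rw [div_le_iff₀ h0]
  nlinarith

lemma eta_eq (R : ℝ) (σ : State N) : eta R σ =
    Real.sqrt (Real.log N / (2 * (1 + R + R ^ 2))) / Real.sqrt (N + σ.cumQ) := by
  rcases Nat.eq_zero_or_pos N with rfl | h
  · simp [eta]
  · have h1 : (1 : ℝ) ≤ N := by exact_mod_cast h
    have h2 := Real.log_nonneg h1
    have : (0 : ℝ) < 1 + R + R ^ 2 := by nlinarith [sq_nonneg (R + 1 / 2)]
    rw [← Real.sqrt_div (by positivity), eta, div_div]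

/-- The learning rate balances the two parts of the regret bound. -/
lemma log_div_eta_add_sum_le (hR : 0 < R) (hN : 2 ≤ N) (s : ℕ → Fin N → Fin N → ℝ)
    (a : ℕ → Fin N) (c : ℕ → Fin N → ℝ) (T : ℕ) (hs : ∀ t < T, ∀ i, s t i i = 1) :
    Real.log N / eta R (state R s a c T) + (1 + R + R ^ 2) * ∑ t ∈ Finset.range T,
      eta R (state R s a c t) * Q R (state R s a c t) (s t) ≤
    4 * (1 + R) * Real.sqrt (Real.log N) * Real.sqrt (N + (state R s a c T).cumQ) := by
  have hσ := state_cumQ_nonneg hR hN s a c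
  have hNr : (0 : ℝ) < N := by positivity
  have hl := log_natCast_pos hN
  have hsum : ∀ n ≤ T, ∑ t ∈ Finset.range n,
      Q R (state R s a c t) (s t) / Real.sqrt (N + (state R s a c t).cumQ) ≤
      3 * Real.sqrt (N + (state R s a c n).cumQ) := by
    intro n hn
    induction n with
    | zero => simp
    | succ n ih =>
      have ih := ih (by omega)
      have h1 := div_sqrt_le (x := N + (state R s a c n).cumQ) (by linarith [hσ n])
        (Q_nonneg hR hN (hσ n) (s n)) ((Q_le hR hN (hσ n) (hs n (by omega))).trans
          (by linarith [hσ n]))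
      have h3 : (N : ℝ) + (state R s a c (n + 1)).cumQ =
        N + (state R s a c n).cumQ + Q R (state R s a c n) (s n) := by
        rw [add_assoc]; rfl
      rw [Finset.sum_range_succ, h3]
      linarith
  have hsum := hsum T le_rfl
  set A := Real.sqrt (N + (state R s a c T).cumQ) with hA
  have hA0 : 0 < A := Real.sqrt_pos.2 (by linarith [hσ T])
  set b := Real.sqrt (2 * (1 + R + R ^ 2)) with hb
  have hb0 : 0 < b := by positivity
  have hb2 : b ^ 2 = 2 * (1 + R + R ^ 2) := Real.sq_sqrt (by positivity)
  set d := Real.sqrt (Real.log N) with hd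
  have hd0 : 0 < d := Real.sqrt_pos.2 hl
  have hd2 : d ^ 2 = Real.log N := Real.sq_sqrt hl.le
  simp only [eta_eq]
  rw [Real.sqrt_div hl.le, ← hA, ← hb, ← hd]
  have e1 : Real.log N / (d / b / A) = b * d * A := by rw [← hd2]; field_simp
  have e2 : ∑ t ∈ Finset.range T, d / b / Real.sqrt (N + (state R s a c t).cumQ) *
      Q R (state R s a c t) (s t) = d / b * ∑ t ∈ Finset.range T,
      Q R (state R s a c t) (s t) / Real.sqrt (N + (state R s a c t).cumQ) := by
    rw [Finset.mul_sum]
    exact Finset.sum_congr rfl fun _ _ => by ring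
  rw [e1, e2]
  have e3 : (1 + R + R ^ 2) = b ^ 2 / 2 := by linarith
  have h5 : (1 + R + R ^ 2) * (d / b * ∑ t ∈ Finset.range T,
      Q R (state R s a c t) (s t) / Real.sqrt (N + (state R s a c t).cumQ)) ≤
      (1 + R + R ^ 2) * (d / b * (3 * A)) := by gcongr
  have e4 : (1 + R + R ^ 2) * (d / b * (3 * A)) = 3 / 2 * b * d * A := by
    rw [e3]; field_simp
  have hb3 : 5 / 2 * b ≤ 4 * (1 + R) := by
    have : b ≤ 8 / 5 * (1 + R) := Real.sqrt_le_iff.2 ⟨by positivity, by nlinarith⟩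
    linarith
  have : 5 / 2 * b * (d * A) ≤ 4 * (1 + R) * (d * A) := by gcongr
  linarith

/-- A deterministic lower bound for the exploration parameter. -/
lemma inv_gamma_le (hR : 0 < R) (hN : 2 ≤ N) {T : ℕ} {σ : State N} (hσ : 0 ≤ σ.cumQ)
    (hσ' : σ.cumQ ≤ T * N) : 1 / gamma R σ ≤ (2 + N + T + 1 / R) ^ 3 := by
  set X : ℝ := 2 + N + T + 1 / R with hX
  have hNr : (2 : ℝ) ≤ N := by exact_mod_cast hN
  have hTr : (0 : ℝ) ≤ T := by positivity
  have hR' : 0 < 1 / R := by positivity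
  have hl : 1 / 2 ≤ Real.log N := by
    have := Real.log_le_log (by norm_num) hNr
    linarith [Real.log_two_gt_d9]
  have hγ := gamma_pos hR hN hσ
  have hX0 : 0 < X := by positivity
  rw [div_le_iff₀ hγ, gamma, eta]
  have h1 : 1 / (R * X ^ 3) ≤
      Real.sqrt (Real.log N / (2 * (1 + R + R ^ 2) * (N + σ.cumQ))) := by
    apply Real.le_sqrt_of_sq_le
    have h2 : 0 < 2 * (1 + R + R ^ 2) * (N + σ.cumQ) := by positivity
    rw [div_pow, one_pow, div_le_div_iff₀ (by positivity) h2, one_mul]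
    have h3 : 1 + R + R ^ 2 ≤ (R * X) ^ 2 := by
      have : R * X = R * (2 + N + T) + 1 := by rw [hX]; field_simp
      rw [this]
      have : R * 1 ≤ R * (2 + N + T) := by gcongr; linarith
      nlinarith
    have h4 : N + σ.cumQ ≤ X ^ 2 := by
      have : (N : ℝ) + σ.cumQ ≤ N * (T + 1) := by linarith
      have h5 : (N : ℝ) * (T + 1) ≤ X * X := by gcongr <;> linarith
      linarith
    have h6 : 4 ≤ X ^ 2 := by nlinarith
    calc 2 * (1 + R + R ^ 2) * (N + σ.cumQ) ≤ 2 * (R * X) ^ 2 * X ^ 2 := by gcongr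
      _ = 1 / 2 * (4 * (R * X) ^ 2 * X ^ 2) := by ring
      _ ≤ 1 / 2 * (X ^ 2 * (R * X) ^ 2 * X ^ 2) := by gcongr
      _ = 1 / 2 * (R * X ^ 3) ^ 2 := by ring
      _ ≤ Real.log N * (R * X ^ 3) ^ 2 := by gcongr
  calc (1 : ℝ) = X ^ 3 * (R * (1 / (R * X ^ 3))) := by field_simp
    _ ≤ _ := by gcongr

end Exp3WIX

/-! ### Expectations over the draw of the arm and over the noise -/

section Draw

variable {Ω : Type*} {N : ℕ}

lemma measurable_apply_arm {mΩ : MeasurableSpace Ω} {I : Ω → Fin N} (hI : Measurable I)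
    {g : Ω → Fin N → ℝ} (hg : ∀ j, Measurable fun ω => g ω j) :
    Measurable fun ω => g ω (I ω) := by
  have h : (fun ω => g ω (I ω)) = fun ω => ∑ j, if I ω = j then g ω j else 0 := by
    funext ω; simp
  rw [h]
  exact Finset.measurable_sum _ fun j _ =>
    Measurable.ite (hI (measurableSet_singleton j)) (hg j) measurable_const

/-- If `I` has conditional distribution `p` given `m'`, then for `m'`-measurable `g` the expectation
of `g (I)` is that of `∑ⱼ pⱼ g (j)`. -/
lemma integral_apply_arm {m' m : MeasurableSpace Ω} (hm : m' ≤ m) {P : Measure Ω}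
    [IsProbabilityMeasure P] {I : Ω → Fin N} (hI : Measurable I) {p : Ω → Fin N → ℝ}
    (hp : ∀ i, P⟦I ⁻¹' {i} | m'⟧ =ᵐ[P] fun ω => p ω i) {g : Ω → Fin N → ℝ}
    (hg : ∀ j, Measurable[m'] fun ω => g ω j) {B : ℝ} (hB : ∀ ω j, |g ω j| ≤ B) :
    ∫ ω, g ω (I ω) ∂P = ∫ ω, ∑ j, p ω j * g ω j ∂P := by
  have hgi : ∀ j, Integrable (fun ω => g ω j) P := fun j =>
    Integrable.of_bound ((hg j).mono hm le_rfl).aestronglyMeasurable B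
      (Filter.Eventually.of_forall fun ω => hB ω j)
  have hind : ∀ j, Integrable ((I ⁻¹' {j}).indicator fun _ => (1 : ℝ)) P := fun j =>
    (integrable_const _).indicator (hI (measurableSet_singleton j))
  have hmul : ∀ j, Integrable ((fun ω => g ω j) * (I ⁻¹' {j}).indicator fun _ => (1 : ℝ)) P :=
    fun j => by
      have : ((fun ω => g ω j) * (I ⁻¹' {j}).indicator fun _ => (1 : ℝ)) =
          (I ⁻¹' {j}).indicator fun ω => g ω j := by
        funext ω; by_cases h : I ω = j <;> simp [Set.indicator, h]
      rw [this]
      exact (hgi j).indicator (hI (measurableSet_singleton j))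
  have hcond : ∀ j, P[(fun ω => g ω j) * (I ⁻¹' {j}).indicator (fun _ => (1 : ℝ)) | m'] =ᵐ[P]
      fun ω => p ω j * g ω j := fun j => by
    filter_upwards [condExp_mul_of_stronglyMeasurable_left (hg j).stronglyMeasurable (hmul j)
      (hind j), hp j] with ω h1 h2
    rw [h1, Pi.mul_apply, h2, mul_comm]
  have e : (fun ω => g ω (I ω)) =
      fun ω => ∑ j, ((fun ω => g ω j) * (I ⁻¹' {j}).indicator fun _ => (1 : ℝ)) ω := by
    funext ω
    simp [Set.indicator]
  rw [e, integral_finsetSum _ fun j _ => hmul j, integral_finsetSum]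
  · refine Finset.sum_congr rfl fun j _ => ?_
    rw [← integral_condExp hm]
    exact integral_congr_ae (hcond j)
  · intro j _
    exact integrable_condExp.congr (hcond j)

/-- Noise that is independent of the history and of the arm averages out. -/
lemma integral_apply_arm_mul_noise {m' m'' m : MeasurableSpace Ω} (hm : m' ≤ m) {P : Measure Ω}
    [IsProbabilityMeasure P] {I : Ω → Fin N} (hI : Measurable I) {ξ : Ω → ℝ} (hξ : Measurable ξ)
    (hξ0 : ∫ ω, ξ ω ∂P = 0)
    (hind : Indep (MeasurableSpace.comap ξ inferInstance)
      (m' ⊔ MeasurableSpace.comap I inferInstance ⊔ m'') P)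
    {g : Ω → Fin N → ℝ} (hg : ∀ j, Measurable[m'] fun ω => g ω j) :
    ∫ ω, g ω (I ω) * ξ ω ∂P = 0 := by
  have hgI : Measurable[m' ⊔ MeasurableSpace.comap I inferInstance] fun ω => g ω (I ω) :=
    measurable_apply_arm (mΩ := m' ⊔ MeasurableSpace.comap I inferInstance)
      ((comap_measurable I).mono le_sup_right le_rfl) fun j => (hg j).mono le_sup_left le_rfl
  have hI' : IndepFun (fun ω => g ω (I ω)) ξ P := by
    rw [IndepFun_iff_Indep]
    exact (indep_of_indep_of_le_right hind (hgI.comap_le.trans le_sup_left)).symm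
  rw [hI'.integral_fun_mul_eq_mul_integral
    (measurable_apply_arm hI fun j => (hg j).mono hm le_rfl).aestronglyMeasurable
    hξ.aestronglyMeasurable, hξ0, mul_zero]

end Draw

/-! ### Measurability of the run of Exp3-WIX -/

namespace Exp3WIX

variable {Ω : Type*} {N : ℕ} {R : ℝ} {mΩ : MeasurableSpace Ω} {σ : Ω → State N}
  {s : Ω → Fin N → Fin N → ℝ}

lemma measurable_eta (h : Measurable fun ω => (σ ω).cumQ) : Measurable fun ω => eta R (σ ω) := by
  unfold eta
  fun_prop

lemma measurable_gamma (h : Measurable fun ω => (σ ω).cumQ) :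
    Measurable fun ω => gamma R (σ ω) :=
  (measurable_eta h).const_mul R

lemma measurable_prob (h : Measurable fun ω => (σ ω).cumQ)
    (h' : ∀ i, Measurable fun ω => (σ ω).cumEst i) (i : Fin N) :
    Measurable fun ω => prob R (σ ω) i := by
  have := measurable_eta (R := R) h
  unfold prob
  fun_prop

lemma measurable_denom (h : Measurable fun ω => (σ ω).cumQ)
    (h' : ∀ i, Measurable fun ω => (σ ω).cumEst i) (hs : ∀ i j, Measurable fun ω => s ω i j)
    (i : Fin N) : Measurable fun ω => denom R (σ ω) (s ω) i := by
  have := measurable_gamma (R := R) h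
  have := measurable_prob (R := R) h h'
  unfold denom
  fun_prop

lemma measurable_Q (h : Measurable fun ω => (σ ω).cumQ)
    (h' : ∀ i, Measurable fun ω => (σ ω).cumEst i) (hs : ∀ i j, Measurable fun ω => s ω i j) :
    Measurable fun ω => Q R (σ ω) (s ω) := by
  have := measurable_prob (R := R) h h'
  have := measurable_denom (R := R) h h' hs
  unfold Q
  fun_prop

lemma measurable_lossEst (h : Measurable fun ω => (σ ω).cumQ)
    (h' : ∀ i, Measurable fun ω => (σ ω).cumEst i) (hs : ∀ i j, Measurable fun ω => s ω i j)
    {a : Ω → Fin N} (ha : Measurable a) {c : Ω → Fin N → ℝ} (hc : ∀ i, Measurable fun ω => c ω i)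
    (i : Fin N) : Measurable fun ω => lossEst R (σ ω) (s ω) (a ω) (c ω) i :=
  ((measurable_apply_arm ha fun j => hs j i).mul (hc i)).div (measurable_denom h h' hs i)

end Exp3WIX

lemma measurable_feedback {Ω : Type*} {N : ℕ} {mΩ : MeasurableSpace Ω} {ℓ : ℕ → Ω → Fin N → ℝ}
    {s : ℕ → Ω → Fin N → Fin N → ℝ} {ξ : ℕ → Ω → Fin N → ℝ} {I : ℕ → Ω → Fin N} {t : ℕ}
    (hℓ : ∀ i, Measurable fun ω => ℓ t ω i) (hs : ∀ i j, Measurable fun ω => s t ω i j)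
    (hξ : ∀ i, Measurable fun ω => ξ t ω i) (hI : Measurable (I t)) (i : Fin N) :
    Measurable fun ω => feedback ℓ s ξ I t ω i :=
  have h := measurable_apply_arm hI fun j => hs j i
  (h.mul (hℓ i)).add ((measurable_const.sub h).mul (hξ i))

section Game

variable {Ω : Type*} {m : MeasurableSpace Ω} {P : Measure Ω} {F : Filtration ℕ m}
  {N T : ℕ} {R : ℝ} {ℓ : ℕ → Ω → Fin N → ℝ} {s : ℕ → Ω → Fin N → Fin N → ℝ}
  {ξ : ℕ → Ω → Fin N → ℝ} {I : ℕ → Ω → Fin N}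

/-- The state of Exp3-WIX at the beginning of round `t`, as a random variable. -/
noncomputable def wixState (R : ℝ) (ℓ : ℕ → Ω → Fin N → ℝ) (s : ℕ → Ω → Fin N → Fin N → ℝ)
    (ξ : ℕ → Ω → Fin N → ℝ) (I : ℕ → Ω → Fin N) (t : ℕ) (ω : Ω) : Exp3WIX.State N :=
  Exp3WIX.state R (fun r => s r ω) (fun r => I r ω) (fun r => feedback ℓ s ξ I r ω) t

/-- The loss estimate of arm `i` in round `t`, as a random variable. -/
noncomputable def wixLossEst (R : ℝ) (ℓ : ℕ → Ω → Fin N → ℝ) (s : ℕ → Ω → Fin N → Fin N → ℝ)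
    (ξ : ℕ → Ω → Fin N → ℝ) (I : ℕ → Ω → Fin N) (t : ℕ) (i : Fin N) (ω : Ω) : ℝ :=
  Exp3WIX.lossEst R (wixState R ℓ s ξ I t ω) (s t ω) (I t ω) (feedback ℓ s ξ I t ω) i

namespace IsNoisyGame

lemma measurable_wixState (h : IsNoisyGame P F T R ℓ s ξ I) {t : ℕ} (ht : t ≤ T) :
    (Measurable[F t] fun ω => (wixState R ℓ s ξ I t ω).cumQ) ∧
      ∀ i, Measurable[F t] fun ω => (wixState R ℓ s ξ I t ω).cumEst i := by
  induction t with
  | zero => exact ⟨measurable_const, fun i => measurable_const⟩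
  | succ t ih =>
    obtain ⟨h1, h2⟩ := ih (by omega)
    have hF : F t ≤ F (t + 1) := F.mono (by omega)
    have h1 := h1.mono hF le_rfl
    have h2 := fun i => (h2 i).mono hF le_rfl
    have hs := fun i j => (h.graph_meas t (by omega) i j).mono hF le_rfl
    have hℓ := fun i => (h.loss_meas t (by omega) i).mono hF le_rfl
    exact ⟨h1.add (Exp3WIX.measurable_Q h1 h2 hs), fun i => (h2 i).add
      (Exp3WIX.measurable_lossEst h1 h2 hs (h.arm_meas t (by omega))
        (measurable_feedback hℓ hs (h.noise_meas t (by omega)) (h.arm_meas t (by omega))) i)⟩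

lemma measurable_arm (h : IsNoisyGame P F T R ℓ s ξ I) {t : ℕ} (ht : t < T) : Measurable (I t) :=
  (h.arm_meas t ht).mono (F.le _) le_rfl

lemma measurable_noise (h : IsNoisyGame P F T R ℓ s ξ I) {t : ℕ} (ht : t < T) (i : Fin N) :
    Measurable fun ω => ξ t ω i :=
  (h.noise_meas t ht i).mono (F.le _) le_rfl

lemma measurable_wixLossEst (h : IsNoisyGame P F T R ℓ s ξ I) {t : ℕ} (ht : t < T) (i : Fin N) :
    Measurable (wixLossEst R ℓ s ξ I t i) := by
  obtain ⟨h1, h2⟩ := h.measurable_wixState ht.le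
  have hF : F t ≤ m := F.le t
  have h1 := h1.mono hF le_rfl
  have h2 := fun i => (h2 i).mono hF le_rfl
  have hs := fun i j => (h.graph_meas t ht i j).mono hF le_rfl
  have hℓ := fun i => (h.loss_meas t ht i).mono hF le_rfl
  exact Exp3WIX.measurable_lossEst h1 h2 hs (h.measurable_arm ht)
    (measurable_feedback hℓ hs (h.measurable_noise ht) (h.measurable_arm ht)) i

lemma cumQ_nonneg (hR : 0 < R) (hN : 2 ≤ N) (t : ℕ) (ω : Ω) :
    0 ≤ (wixState R ℓ s ξ I t ω).cumQ :=
  Exp3WIX.state_cumQ_nonneg hR hN _ _ _ t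

lemma cumQ_le (h : IsNoisyGame P F T R ℓ s ξ I) (hR : 0 < R) (hN : 2 ≤ N) {t : ℕ} (ht : t ≤ T)
    (ω : Ω) : (wixState R ℓ s ξ I t ω).cumQ ≤ T * N := by
  refine (Exp3WIX.state_cumQ_le hR hN _ _ _ t fun r hr => h.graph_self r (by omega) ω).trans ?_
  gcongr

lemma inv_denom_le (h : IsNoisyGame P F T R ℓ s ξ I) (hR : 0 < R) (hN : 2 ≤ N) {t : ℕ}
    (ht : t ≤ T) (ω : Ω) (i : Fin N) :
    1 / Exp3WIX.denom R (wixState R ℓ s ξ I t ω) (s t ω) i ≤ (2 + N + T + 1 / R) ^ 3 := by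
  refine le_trans ?_ (Exp3WIX.inv_gamma_le hR hN (cumQ_nonneg hR hN t ω) (h.cumQ_le hR hN ht ω))
  exact one_div_le_one_div_of_le (Exp3WIX.gamma_pos hR hN (cumQ_nonneg hR hN t ω))
    (Exp3WIX.gamma_le_denom (by omega) _ _ _)

lemma abs_feedback_le (h : IsNoisyGame P F T R ℓ s ξ I) {t : ℕ} (ht : t < T) (i : Fin N) {ω : Ω}
    (hω : |ξ t ω i| ≤ R) : |feedback ℓ s ξ I t ω i| ≤ 1 + R := by
  obtain ⟨a1, a2⟩ := h.loss_mem t ht ω i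
  obtain ⟨b1, b2⟩ := h.graph_mem t ht ω (I t ω) i
  obtain ⟨c1, c2⟩ := abs_le.1 hω
  unfold feedback
  rw [abs_le]
  constructor <;> nlinarith

lemma feedback_sq_le (h : IsNoisyGame P F T R ℓ s ξ I) {t : ℕ} (ht : t < T) (i : Fin N) {ω : Ω}
    (hω : |ξ t ω i| ≤ R) : feedback ℓ s ξ I t ω i ^ 2 ≤ 1 + R ^ 2 := by
  obtain ⟨a1, a2⟩ := h.loss_mem t ht ω i
  obtain ⟨b1, b2⟩ := h.graph_mem t ht ω (I t ω) i
  have hξ : ξ t ω i ^ 2 ≤ R ^ 2 := sq_le_sq' (abs_le.1 hω).1 (abs_le.1 hω).2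
  have hl : ℓ t ω i ^ 2 ≤ 1 := pow_le_one₀ a1 a2
  unfold feedback
  set u := s t ω (I t ω) i
  -- convexity of the square
  have : (u * ℓ t ω i + (1 - u) * ξ t ω i) ^ 2 ≤ u * ℓ t ω i ^ 2 + (1 - u) * ξ t ω i ^ 2 := by
    nlinarith [mul_nonneg (mul_nonneg b1 (sub_nonneg.2 b2)) (sq_nonneg (ℓ t ω i - ξ t ω i))]
  nlinarith [sq_nonneg R]

lemma neg_le_weight_mul_feedback (h : IsNoisyGame P F T R ℓ s ξ I) (hR : 0 < R) {t : ℕ}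
    (ht : t < T) (i : Fin N) {ω : Ω} (hω : |ξ t ω i| ≤ R) :
    -R ≤ s t ω (I t ω) i * feedback ℓ s ξ I t ω i := by
  obtain ⟨a1, a2⟩ := h.loss_mem t ht ω i
  obtain ⟨b1, b2⟩ := h.graph_mem t ht ω (I t ω) i
  obtain ⟨c1, c2⟩ := abs_le.1 hω
  have : -R ≤ feedback ℓ s ξ I t ω i := by
    unfold feedback
    nlinarith [mul_nonneg b1 a1]
  nlinarith

lemma abs_wixLossEst_le (h : IsNoisyGame P F T R ℓ s ξ I) (hR : 0 < R) (hN : 2 ≤ N) {t : ℕ}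
    (ht : t < T) (i : Fin N) :
    ∀ᵐ ω ∂P, |wixLossEst R ℓ s ξ I t i ω| ≤ (1 + R) * (2 + N + T + 1 / R) ^ 3 := by
  filter_upwards [h.noise_bound t ht i] with ω hω
  have hD := Exp3WIX.denom_pos hR hN (cumQ_nonneg (ℓ := ℓ) (s := s) (ξ := ξ) (I := I) hR hN t ω)
    (s t ω) i
  have h1 := h.inv_denom_le hR hN ht.le ω i
  obtain ⟨b1, b2⟩ := h.graph_mem t ht ω (I t ω) i
  have h2 := h.abs_feedback_le ht i hω
  unfold wixLossEst Exp3WIX.lossEst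
  rw [div_eq_mul_one_div, abs_mul, abs_mul, abs_of_nonneg b1, abs_of_nonneg (one_div_pos.2 hD).le]
  gcongr
  calc _ ≤ 1 * (1 + R) := by gcongr
    _ = _ := one_mul _

/-- The loss estimates are biased only by the factor `(D - γ) / D`, where `D` is the denominator of
the estimate. -/
lemma integral_mul_wixLossEst [IsProbabilityMeasure P] (h : IsNoisyGame P F T R ℓ s ξ I)
    (hplay : PlaysExp3WIX P F T R ℓ s ξ I) (hR : 0 < R) (hN : 2 ≤ N) {t : ℕ} (ht : t < T)
    (i : Fin N) {g : Ω → ℝ} (hg : Measurable[F t] g) (hg0 : ∀ ω, 0 ≤ g ω) (hg1 : ∀ ω, g ω ≤ 1) :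
    ∫ ω, g ω * wixLossEst R ℓ s ξ I t i ω ∂P =
      ∫ ω, g ω * ℓ t ω i * ((Exp3WIX.denom R (wixState R ℓ s ξ I t ω) (s t ω) i -
        Exp3WIX.gamma R (wixState R ℓ s ξ I t ω)) /
          Exp3WIX.denom R (wixState R ℓ s ξ I t ω) (s t ω) i) ∂P := by
  obtain ⟨h1, h2⟩ := h.measurable_wixState ht.le
  have hs := h.graph_meas t ht
  have hℓ := h.loss_meas t ht
  have hD := Exp3WIX.measurable_denom (R := R) h1 h2 hs i
  set D := fun ω => Exp3WIX.denom R (wixState R ℓ s ξ I t ω) (s t ω) i with hDdef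
  have hD0 : ∀ ω, 0 < D ω := fun ω => Exp3WIX.denom_pos hR hN (cumQ_nonneg hR hN t ω) (s t ω) i
  have hDX := fun ω => h.inv_denom_le hR hN ht.le ω i
  set X : ℝ := (2 + N + T + 1 / R) ^ 3
  -- the parts of the estimate that come from the loss and from the noise
  set u : Ω → Fin N → ℝ := fun ω j => g ω * (s t ω j i ^ 2 * ℓ t ω i) * (1 / D ω) with hu
  set v : Ω → Fin N → ℝ := fun ω j => g ω * (s t ω j i * (1 - s t ω j i)) * (1 / D ω) with hv
  have hum : ∀ j, Measurable[F t] fun ω => u ω j := fun j =>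
    (hg.mul (((hs j i).pow_const 2).mul (hℓ i))).mul (measurable_const.div hD)
  have hvm : ∀ j, Measurable[F t] fun ω => v ω j := fun j =>
    (hg.mul ((hs j i).mul (measurable_const.sub (hs j i)))).mul (measurable_const.div hD)
  have hbound : ∀ ω, ∀ x, 0 ≤ x → x ≤ 1 → |g ω * x * (1 / D ω)| ≤ X := fun ω x hx0 hx1 => by
    have := one_div_pos.2 (hD0 ω)
    rw [abs_of_nonneg (mul_nonneg (mul_nonneg (hg0 ω) hx0) this.le)]
    calc g ω * x * (1 / D ω) ≤ 1 * 1 * X := by gcongr; exacts [hg1 ω, hDX ω]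
      _ = X := by ring
  have hub : ∀ ω j, |u ω j| ≤ X := fun ω j => by
    obtain ⟨a1, a2⟩ := h.loss_mem t ht ω i
    obtain ⟨b1, b2⟩ := h.graph_mem t ht ω j i
    exact hbound ω _ (by positivity) (mul_le_one₀ (pow_le_one₀ b1 b2) a1 a2)
  have hvb : ∀ ω j, |v ω j| ≤ X := fun ω j => by
    obtain ⟨b1, b2⟩ := h.graph_mem t ht ω j i
    exact hbound ω _ (by nlinarith) (by nlinarith)
  have hI := h.measurable_arm ht
  have e : (fun ω => g ω * wixLossEst R ℓ s ξ I t i ω) =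
      fun ω => u ω (I t ω) + v ω (I t ω) * ξ t ω i := by
    funext ω
    simp only [hu, hv, wixLossEst, Exp3WIX.lossEst, feedback, hDdef]
    ring
  have hui : Integrable (fun ω => u ω (I t ω)) P :=
    Integrable.of_bound (measurable_apply_arm hI fun j =>
      (hum j).mono (F.le t) le_rfl).aestronglyMeasurable X
      (Filter.Eventually.of_forall fun ω => hub ω _)
  have hvi : Integrable (fun ω => v ω (I t ω) * ξ t ω i) P := by
    refine Integrable.of_bound ((measurable_apply_arm hI fun j =>
      (hvm j).mono (F.le t) le_rfl).mul (h.measurable_noise ht i)).aestronglyMeasurable (X * R) ?_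
    filter_upwards [h.noise_bound t ht i] with ω hω
    rw [Real.norm_eq_abs, abs_mul]
    have := hvb ω (I t ω)
    have := (abs_nonneg _).trans this
    gcongr
  rw [e, integral_add hui hvi, integral_apply_arm_mul_noise (F.le t) hI (h.measurable_noise ht i)
    (h.noise_mean t ht i) (h.noise_indep t ht i) hvm, add_zero,
    integral_apply_arm (F.le t) hI (hplay t ht) hum hub]
  refine integral_congr_ae (Filter.Eventually.of_forall fun ω => ?_)
  have hden : D ω - Exp3WIX.gamma R (wixState R ℓ s ξ I t ω) =
      ∑ j, wixProb R ℓ s ξ I t ω j * s t ω j i ^ 2 := by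
    simp only [hDdef, Exp3WIX.denom, add_sub_cancel_right]
    rfl
  have hDω : Exp3WIX.denom R (wixState R ℓ s ξ I t ω) (s t ω) i = D ω := rfl
  simp only [hDω, hden, hu]
  rw [Finset.sum_div, Finset.mul_sum]
  exact Finset.sum_congr rfl fun j _ => by ring

/-- The second moment of the loss estimates. -/
lemma integral_mul_wixLossEst_sq_le [IsProbabilityMeasure P] (h : IsNoisyGame P F T R ℓ s ξ I)
    (hplay : PlaysExp3WIX P F T R ℓ s ξ I) (hR : 0 < R) (hN : 2 ≤ N) {t : ℕ} (ht : t < T)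
    (i : Fin N) {g : Ω → ℝ} (hg : Measurable[F t] g) (hg0 : ∀ ω, 0 ≤ g ω) {B : ℝ}
    (hg1 : ∀ ω, g ω ≤ B) :
    ∫ ω, g ω * wixLossEst R ℓ s ξ I t i ω ^ 2 ∂P ≤
      ∫ ω, (1 + R ^ 2) * (g ω / Exp3WIX.denom R (wixState R ℓ s ξ I t ω) (s t ω) i) ∂P := by
  obtain ⟨h1, h2⟩ := h.measurable_wixState ht.le
  have hs := h.graph_meas t ht
  have hD := Exp3WIX.measurable_denom (R := R) h1 h2 hs i
  set D := fun ω => Exp3WIX.denom R (wixState R ℓ s ξ I t ω) (s t ω) i with hDdef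
  have hD0 : ∀ ω, 0 < D ω := fun ω => Exp3WIX.denom_pos hR hN (cumQ_nonneg hR hN t ω) (s t ω) i
  have hDX := fun ω => h.inv_denom_le hR hN ht.le ω i
  set X : ℝ := (2 + N + T + 1 / R) ^ 3
  set u : Ω → Fin N → ℝ :=
    fun ω j => g ω * (1 + R ^ 2) * s t ω j i ^ 2 * (1 / D ω) ^ 2 with hu
  have hum : ∀ j, Measurable[F t] fun ω => u ω j := fun j =>
    ((hg.mul_const _).mul ((hs j i).pow_const 2)).mul ((measurable_const.div hD).pow_const 2)
  have hub : ∀ ω j, |u ω j| ≤ B * (1 + R ^ 2) * 1 * X ^ 2 := fun ω j => by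
    obtain ⟨b1, b2⟩ := h.graph_mem t ht ω j i
    have hd := one_div_pos.2 (hD0 ω)
    have := hg0 ω
    have hB := this.trans (hg1 ω)
    simp only [hu]
    rw [abs_of_nonneg (by positivity)]
    gcongr
    exacts [hg1 ω, pow_le_one₀ b1 b2, hDX ω]
  have hI := h.measurable_arm ht
  have hui : Integrable (fun ω => u ω (I t ω)) P :=
    Integrable.of_bound (measurable_apply_arm hI fun j =>
      (hum j).mono (F.le t) le_rfl).aestronglyMeasurable _
      (Filter.Eventually.of_forall fun ω => hub ω _)
  have hgm := hg.mono (F.le t) le_rfl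
  have hDm := hD.mono (F.le t) le_rfl
  calc ∫ ω, g ω * wixLossEst R ℓ s ξ I t i ω ^ 2 ∂P ≤ ∫ ω, u ω (I t ω) ∂P := by
        refine integral_mono_of_nonneg (Filter.Eventually.of_forall fun ω =>
          mul_nonneg (hg0 ω) (sq_nonneg _)) hui ?_
        filter_upwards [h.noise_bound t ht i] with ω hω
        have hc := h.feedback_sq_le ht i hω
        have e : g ω * wixLossEst R ℓ s ξ I t i ω ^ 2 =
            g ω * s t ω (I t ω) i ^ 2 * (1 / D ω) ^ 2 * feedback ℓ s ξ I t ω i ^ 2 := by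
          simp only [wixLossEst, Exp3WIX.lossEst, hDdef]
          ring
        have e' : u ω (I t ω) =
            g ω * s t ω (I t ω) i ^ 2 * (1 / D ω) ^ 2 * (1 + R ^ 2) := by
          simp only [hu]; ring
        rw [e, e']
        have := hg0 ω
        gcongr
    _ = ∫ ω, ∑ j, wixProb R ℓ s ξ I t ω j * u ω j ∂P :=
        integral_apply_arm (F.le t) hI (hplay t ht) hum hub
    _ ≤ ∫ ω, (1 + R ^ 2) * (g ω / D ω) ∂P := by
        refine integral_mono_of_nonneg (Filter.Eventually.of_forall fun ω =>
          Finset.sum_nonneg fun j _ => ?_) ?_ (Filter.Eventually.of_forall fun ω => ?_)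
        · have h3 : 0 < wixProb R ℓ s ξ I t ω j := Exp3WIX.prob_pos (by omega) _ _
          have := hg0 ω
          simp only [hu]
          positivity
        · refine Integrable.of_bound
            ((hgm.div hDm).const_mul (1 + R ^ 2)).aestronglyMeasurable ((1 + R ^ 2) * (B * X))
            (Filter.Eventually.of_forall fun ω => ?_)
          have hd := one_div_pos.2 (hD0 ω)
          have := hg0 ω
          have hB := this.trans (hg1 ω)
          rw [Real.norm_eq_abs, abs_of_nonneg (mul_nonneg (by positivity)
            (div_nonneg this (hD0 ω).le)), div_eq_mul_one_div]
          gcongr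
          exacts [hg1 ω, hDX ω]
        · have e : ∑ j, wixProb R ℓ s ξ I t ω j * u ω j =
              (1 + R ^ 2) * g ω * (1 / D ω) ^ 2 *
                ∑ j, wixProb R ℓ s ξ I t ω j * s t ω j i ^ 2 := by
            rw [Finset.mul_sum]
            exact Finset.sum_congr rfl fun j _ => by simp only [hu]; ring
          have hle : ∑ j, wixProb R ℓ s ξ I t ω j * s t ω j i ^ 2 ≤ D ω :=
            le_add_of_nonneg_right (Exp3WIX.gamma_pos hR hN (cumQ_nonneg hR hN t ω)).le
          refine e.trans_le ?_
          have := hg0 ω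
          calc _ ≤ (1 + R ^ 2) * g ω * (1 / D ω) ^ 2 * D ω := by gcongr
            _ = (1 + R ^ 2) * (g ω / D ω) := by
              have := (hD0 ω).ne'
              field_simp

end IsNoisyGame

end Game

/-! ### From estimated to true regret -/

section Game

variable {Ω : Type*} {m : MeasurableSpace Ω} {P : Measure Ω} {F : Filtration ℕ m}
  {N T : ℕ} {R : ℝ} {ℓ : ℕ → Ω → Fin N → ℝ} {s : ℕ → Ω → Fin N → Fin N → ℝ}
  {ξ : ℕ → Ω → Fin N → ℝ} {I : ℕ → Ω → Fin N}

/-- The regret of round `t` against arm `k` in terms of the estimated losses, after the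
second-order term of exponential weights has been deducted. -/
noncomputable def wixEstRegret (R : ℝ) (ℓ : ℕ → Ω → Fin N → ℝ) (s : ℕ → Ω → Fin N → Fin N → ℝ)
    (ξ : ℕ → Ω → Fin N → ℝ) (I : ℕ → Ω → Fin N) (t : ℕ) (k : Fin N) (ω : Ω) : ℝ :=
  ∑ i, wixProb R ℓ s ξ I t ω i * wixLossEst R ℓ s ξ I t i ω - wixLossEst R ℓ s ξ I t k ω -
    Exp3WIX.eta R (wixState R ℓ s ξ I t ω) *
      ∑ i, wixProb R ℓ s ξ I t ω i * wixLossEst R ℓ s ξ I t i ω ^ 2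

/-- The quantity `η_t Q_t`, as a random variable. -/
noncomputable def wixEtaQ (R : ℝ) (ℓ : ℕ → Ω → Fin N → ℝ) (s : ℕ → Ω → Fin N → Fin N → ℝ)
    (ξ : ℕ → Ω → Fin N → ℝ) (I : ℕ → Ω → Fin N) (t : ℕ) (ω : Ω) : ℝ :=
  Exp3WIX.eta R (wixState R ℓ s ξ I t ω) * Exp3WIX.Q R (wixState R ℓ s ξ I t ω) (s t ω)

namespace IsNoisyGame

lemma eta_le (hR : 0 < R) (hN : 2 ≤ N) (t : ℕ) (ω : Ω) :
    Exp3WIX.eta R (wixState R ℓ s ξ I t ω) ≤ Exp3WIX.eta R (⟨fun _ => 0, 0⟩ : Exp3WIX.State N) :=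
  Exp3WIX.eta_anti hR hN le_rfl (cumQ_nonneg hR hN t ω)

lemma integrable_arm_loss [IsProbabilityMeasure P] (h : IsNoisyGame P F T R ℓ s ξ I) {t : ℕ}
    (ht : t < T) : Integrable (fun ω => ℓ t ω (I t ω)) P := by
  refine Integrable.of_bound (measurable_apply_arm (h.measurable_arm ht) fun j =>
    (h.loss_meas t ht j).mono (F.le t) le_rfl).aestronglyMeasurable 1
    (Filter.Eventually.of_forall fun ω => ?_)
  obtain ⟨a1, a2⟩ := h.loss_mem t ht ω (I t ω)
  rwa [Real.norm_eq_abs, abs_of_nonneg a1]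

lemma integrable_loss [IsProbabilityMeasure P] (h : IsNoisyGame P F T R ℓ s ξ I) {t : ℕ}
    (ht : t < T) (k : Fin N) : Integrable (fun ω => ℓ t ω k) P := by
  refine Integrable.of_bound ((h.loss_meas t ht k).mono (F.le t) le_rfl).aestronglyMeasurable 1
    (Filter.Eventually.of_forall fun ω => ?_)
  obtain ⟨a1, a2⟩ := h.loss_mem t ht ω k
  rwa [Real.norm_eq_abs, abs_of_nonneg a1]

lemma measurable_wixProb (h : IsNoisyGame P F T R ℓ s ξ I) {t : ℕ} (ht : t < T) (i : Fin N) :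
    Measurable[F t] fun ω => wixProb R ℓ s ξ I t ω i :=
  Exp3WIX.measurable_prob (h.measurable_wixState ht.le).1 (h.measurable_wixState ht.le).2 i

lemma measurable_wixEta (h : IsNoisyGame P F T R ℓ s ξ I) {t : ℕ} (ht : t < T) :
    Measurable[F t] fun ω => Exp3WIX.eta R (wixState R ℓ s ξ I t ω) :=
  Exp3WIX.measurable_eta (h.measurable_wixState ht.le).1

lemma wixProb_pos (hN : 2 ≤ N) (t : ℕ) (ω : Ω) (i : Fin N) : 0 < wixProb R ℓ s ξ I t ω i :=
  Exp3WIX.prob_pos (by omega) _ i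

lemma wixProb_le_one (hN : 2 ≤ N) (t : ℕ) (ω : Ω) (i : Fin N) : wixProb R ℓ s ξ I t ω i ≤ 1 :=
  Exp3WIX.prob_le_one (by omega) _ i

lemma integrable_wixEtaQ [IsProbabilityMeasure P] (h : IsNoisyGame P F T R ℓ s ξ I)
    (hR : 0 < R) (hN : 2 ≤ N) {t : ℕ} (ht : t < T) : Integrable (wixEtaQ R ℓ s ξ I t) P := by
  obtain ⟨h1, h2⟩ := h.measurable_wixState ht.le
  refine Integrable.of_bound (((h.measurable_wixEta ht).mul
    (Exp3WIX.measurable_Q h1 h2 (h.graph_meas t ht))).mono (F.le t) le_rfl).aestronglyMeasurable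
    (Exp3WIX.eta R (⟨fun _ => 0, 0⟩ : Exp3WIX.State N) * N)
    (Filter.Eventually.of_forall fun ω => ?_)
  have hσ := cumQ_nonneg (ℓ := ℓ) (s := s) (ξ := ξ) (I := I) hR hN t ω
  have a := Exp3WIX.Q_nonneg hR hN hσ (s t ω)
  have b := (Exp3WIX.eta_pos hR hN hσ).le
  rw [Real.norm_eq_abs, wixEtaQ, abs_of_nonneg (mul_nonneg b a)]
  exact mul_le_mul (eta_le hR hN t ω) (Exp3WIX.Q_le hR hN hσ (h.graph_self t ht ω)) a
    (b.trans (eta_le hR hN t ω))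

lemma integrable_mul_wixLossEst [IsProbabilityMeasure P] (h : IsNoisyGame P F T R ℓ s ξ I)
    (hR : 0 < R) (hN : 2 ≤ N) {t : ℕ} (ht : t < T) (i : Fin N) {g : Ω → ℝ}
    (hg : Measurable[F t] g) {B : ℝ} (hB : ∀ ω, |g ω| ≤ B) (n : ℕ) :
    Integrable (fun ω => g ω * wixLossEst R ℓ s ξ I t i ω ^ n) P := by
  refine Integrable.of_bound ((hg.mono (F.le t) le_rfl).mul
    ((h.measurable_wixLossEst ht i).pow_const n)).aestronglyMeasurable
    (B * ((1 + R) * (2 + N + T + 1 / R) ^ 3) ^ n) ?_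
  filter_upwards [h.abs_wixLossEst_le hR hN ht i] with ω hω
  rw [Real.norm_eq_abs, abs_mul, abs_pow]
  have := (abs_nonneg _).trans (hB ω)
  gcongr
  exact hB ω

/-- Per-round regret: the implicit exploration costs `γ Q = R η Q` and the second-order term costs
`(1 + R²) η Q`. -/
lemma integral_regret_le [IsProbabilityMeasure P] (h : IsNoisyGame P F T R ℓ s ξ I)
    (hplay : PlaysExp3WIX P F T R ℓ s ξ I) (hR : 0 < R) (hN : 2 ≤ N) {t : ℕ} (ht : t < T)
    (k : Fin N) :
    Integrable (wixEstRegret R ℓ s ξ I t k) P ∧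
    ∫ ω, (ℓ t ω (I t ω) - ℓ t ω k) ∂P ≤ ∫ ω, wixEstRegret R ℓ s ξ I t k ω ∂P +
      (1 + R + R ^ 2) * ∫ ω, wixEtaQ R ℓ s ξ I t ω ∂P := by
  set p : Fin N → Ω → ℝ := fun i ω => wixProb R ℓ s ξ I t ω i with hp
  set H : Fin N → Ω → ℝ := wixLossEst R ℓ s ξ I t with hH
  set η : Ω → ℝ := fun ω => Exp3WIX.eta R (wixState R ℓ s ξ I t ω) with hη
  set D : Fin N → Ω → ℝ :=
    fun i ω => Exp3WIX.denom R (wixState R ℓ s ξ I t ω) (s t ω) i with hD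
  set B := Exp3WIX.eta R (⟨fun _ => 0, 0⟩ : Exp3WIX.State N) with hBdef
  have hσ := fun ω => cumQ_nonneg (ℓ := ℓ) (s := s) (ξ := ξ) (I := I) hR hN t ω
  have hp0 : ∀ i ω, 0 < p i ω := fun i ω => wixProb_pos hN t ω i
  have hp1 : ∀ i ω, p i ω ≤ 1 := fun i ω => wixProb_le_one hN t ω i
  have hη0 : ∀ ω, 0 < η ω := fun ω => Exp3WIX.eta_pos hR hN (hσ ω)
  have hηB : ∀ ω, η ω ≤ B := fun ω => eta_le hR hN t ω
  have hD0 : ∀ i ω, 0 < D i ω := fun i ω => Exp3WIX.denom_pos hR hN (hσ ω) _ i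
  have hpD : ∀ i ω, p i ω / D i ω ≤ 1 := fun i ω => div_le_one_of_le₀
    (Exp3WIX.prob_le_denom hR hN (hσ ω) (h.graph_self t ht ω) i) (hD0 i ω).le
  have hpm : ∀ i, Measurable[F t] (p i) := h.measurable_wixProb ht
  have hηm : Measurable[F t] η := h.measurable_wixEta ht
  have hDm : ∀ i, Measurable[F t] (D i) := fun i =>
    Exp3WIX.measurable_denom (h.measurable_wixState ht.le).1 (h.measurable_wixState ht.le).2
      (h.graph_meas t ht) i
  have hpηB : ∀ i ω, η ω * p i ω ≤ B := fun i ω =>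
    (mul_le_of_le_one_right (hη0 ω).le (hp1 i ω)).trans (hηB ω)
  have int1 : ∀ i, Integrable (fun ω => p i ω * H i ω) P := fun i => by
    simpa using h.integrable_mul_wixLossEst hR hN ht i (hpm i) (B := 1)
      (fun ω => by rw [abs_of_pos (hp0 i ω)]; exact hp1 i ω) 1
  have int2 : Integrable (H k) P := by
    simpa using h.integrable_mul_wixLossEst hR hN ht k (g := fun _ => 1) measurable_const (B := 1)
      (fun ω => by simp) 1
  have int3 : ∀ i, Integrable (fun ω => η ω * p i ω * H i ω ^ 2) P := fun i =>
    h.integrable_mul_wixLossEst hR hN ht i (hηm.mul (hpm i)) (B := B)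
      (fun ω => by rw [Pi.mul_apply, abs_of_pos (mul_pos (hη0 ω) (hp0 i ω))]; exact hpηB i ω) 2
  have int4 : ∀ i, Integrable (fun ω => η ω * p i ω / D i ω) P := fun i => by
    refine Integrable.of_bound (((hηm.mul (hpm i)).div (hDm i)).mono
      (F.le t) le_rfl).aestronglyMeasurable B (Filter.Eventually.of_forall fun ω => ?_)
    have h1 := hη0 ω
    have h2 := hp0 i ω
    have h3 := hD0 i ω
    rw [Real.norm_eq_abs, abs_of_pos (by positivity), mul_div_assoc]
    exact (mul_le_of_le_one_right h1.le (hpD i ω)).trans (hηB ω)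
  have int5 : ∀ i, Integrable (fun ω => p i ω * ℓ t ω i) P := fun i => by
    refine Integrable.of_bound (((hpm i).mul (h.loss_meas t ht i)).mono
      (F.le t) le_rfl).aestronglyMeasurable 1 (Filter.Eventually.of_forall fun ω => ?_)
    obtain ⟨a1, a2⟩ := h.loss_mem t ht ω i
    rw [Real.norm_eq_abs, abs_of_nonneg (mul_nonneg (hp0 i ω).le a1)]
    exact mul_le_one₀ (hp1 i ω) a1 a2
  have eX : wixEstRegret R ℓ s ξ I t k = fun ω =>
      (∑ i, p i ω * H i ω - H k ω) - ∑ i, η ω * p i ω * H i ω ^ 2 := by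
    funext ω
    simp only [wixEstRegret, Finset.mul_sum, mul_assoc, hp, hH, hη]
  have eQ : wixEtaQ R ℓ s ξ I t = fun ω => ∑ i, η ω * p i ω / D i ω := by
    funext ω
    simp only [wixEtaQ, Exp3WIX.Q, Finset.mul_sum, mul_div_assoc]
    rfl
  have iX1 : Integrable (fun ω => ∑ i, p i ω * H i ω) P := integrable_finsetSum _ fun i _ => int1 i
  have iX3 : Integrable (fun ω => ∑ i, η ω * p i ω * H i ω ^ 2) P :=
    integrable_finsetSum _ fun i _ => int3 i
  refine ⟨by rw [eX]; exact (iX1.sub int2).sub iX3, ?_⟩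
  have eIX : ∫ ω, wixEstRegret R ℓ s ξ I t k ω ∂P = ∑ i, ∫ ω, p i ω * H i ω ∂P -
      ∫ ω, H k ω ∂P - ∑ i, ∫ ω, η ω * p i ω * H i ω ^ 2 ∂P := by
    rw [eX, ← integral_finsetSum _ fun i _ => int1 i, ← integral_finsetSum _ fun i _ => int3 i,
      ← integral_sub iX1 int2]
    exact integral_sub (iX1.sub int2) iX3
  have eIQ : ∫ ω, wixEtaQ R ℓ s ξ I t ω ∂P = ∑ i, ∫ ω, η ω * p i ω / D i ω ∂P := by
    rw [eQ, ← integral_finsetSum _ fun i _ => int4 i]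
  rw [eIX, eIQ, integral_sub (h.integrable_arm_loss ht) (h.integrable_loss ht k)]
  have hdraw : ∫ ω, ℓ t ω (I t ω) ∂P = ∑ i, ∫ ω, p i ω * ℓ t ω i ∂P := by
    rw [integral_apply_arm (F.le t) (h.measurable_arm ht) (hplay t ht) (h.loss_meas t ht) (B := 1),
      integral_finsetSum _ fun i _ => int5 i]
    intro ω j
    obtain ⟨a1, a2⟩ := h.loss_mem t ht ω j
    rwa [abs_of_nonneg a1]
  have hbias : ∀ i, ∫ ω, p i ω * ℓ t ω i ∂P - R * ∫ ω, η ω * p i ω / D i ω ∂P ≤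
      ∫ ω, p i ω * H i ω ∂P := fun i => by
    rw [h.integral_mul_wixLossEst hplay hR hN ht i (hpm i) (fun ω => (hp0 i ω).le) (hp1 i),
      ← integral_const_mul, ← integral_sub (int5 i) ((int4 i).const_mul R)]
    have hle1 : ∀ ω, (D i ω - Exp3WIX.gamma R (wixState R ℓ s ξ I t ω)) / D i ω =
        1 - R * η ω / D i ω := fun ω => by
      rw [sub_div, div_self (hD0 i ω).ne']; rfl
    refine integral_mono ((int5 i).sub ((int4 i).const_mul R)) ?_ fun ω => ?_
    · refine Integrable.mono' (int5 i) ((((hpm i).mul (h.loss_meas t ht i)).mul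
        (((hDm i).sub ((hηm).const_mul R)).div (hDm i))).mono
        (F.le t) le_rfl).aestronglyMeasurable (Filter.Eventually.of_forall fun ω => ?_)
      obtain ⟨a1, a2⟩ := h.loss_mem t ht ω i
      have h1 := mul_nonneg (hp0 i ω).le a1
      have h2 : 0 ≤ (D i ω - Exp3WIX.gamma R (wixState R ℓ s ξ I t ω)) / D i ω :=
        div_nonneg (sub_nonneg.2 (Exp3WIX.gamma_le_denom (by omega) _ _ _)) (hD0 i ω).le
      have h3 : (D i ω - Exp3WIX.gamma R (wixState R ℓ s ξ I t ω)) / D i ω ≤ 1 := by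
        rw [hle1]
        linarith [div_nonneg (mul_nonneg hR.le (hη0 ω).le) (hD0 i ω).le]
      rw [Real.norm_eq_abs, abs_of_nonneg (mul_nonneg h1 h2)]
      exact mul_le_of_le_one_right h1 h3
    · obtain ⟨a1, a2⟩ := h.loss_mem t ht ω i
      have := hle1 ω
      simp only [hD] at this
      simp only
      rw [this]
      have h1 : 0 ≤ R * (η ω * p i ω / D i ω) :=
        mul_nonneg hR.le (div_nonneg (mul_nonneg (hη0 ω).le (hp0 i ω).le) (hD0 i ω).le)
      have e : p i ω * ℓ t ω i * (1 - R * η ω / D i ω) =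
        p i ω * ℓ t ω i - ℓ t ω i * (R * (η ω * p i ω / D i ω)) := by ring
      refine le_trans ?_ e.ge
      nlinarith
  have hk : ∫ ω, H k ω ∂P ≤ ∫ ω, ℓ t ω k ∂P := by
    have e := h.integral_mul_wixLossEst hplay hR hN ht k (g := fun _ => 1) measurable_const
      (fun _ => zero_le_one) (fun _ => le_rfl)
    simp only [one_mul] at e
    rw [hH, e]
    refine integral_mono_of_nonneg (Filter.Eventually.of_forall fun ω => ?_)
      (h.integrable_loss ht k) (Filter.Eventually.of_forall fun ω => ?_)
    · exact mul_nonneg (h.loss_mem t ht ω k).1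
        (div_nonneg (sub_nonneg.2 (Exp3WIX.gamma_le_denom (by omega) _ _ _)) (hD0 k ω).le)
    · refine mul_le_of_le_one_right (h.loss_mem t ht ω k).1 (div_le_one_of_le₀ ?_ (hD0 k ω).le)
      exact sub_le_self _ (Exp3WIX.gamma_pos hR hN (hσ ω)).le
  have hsq : ∀ i, ∫ ω, η ω * p i ω * H i ω ^ 2 ∂P ≤
      (1 + R ^ 2) * ∫ ω, η ω * p i ω / D i ω ∂P := fun i => by
    rw [← integral_const_mul]
    exact h.integral_mul_wixLossEst_sq_le hplay hR hN ht i (hηm.mul (hpm i))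
      (fun ω => (mul_pos (hη0 ω) (hp0 i ω)).le) (hpηB i)
  have s1 := Finset.sum_le_sum fun i (_ : i ∈ Finset.univ) => hbias i
  have s2 := Finset.sum_le_sum fun i (_ : i ∈ Finset.univ) => hsq i
  rw [Finset.sum_sub_distrib, ← Finset.mul_sum] at s1
  rw [← Finset.mul_sum] at s2
  rw [hdraw]
  linarith

/-! ### The regret bound -/

/-- The sum of the `Q`'s, in terms of the effective independence numbers. -/
lemma natCast_add_cumQ_le (h : IsNoisyGame P F T R ℓ s ξ I) (hR : 0 < R) (hN : 2 ≤ N) (ω : Ω) :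
    N + (wixState R ℓ s ξ I T ω).cumQ ≤ 8 * Real.log (2 + N + T + 1 / R) *
      (N + ∑ t ∈ Finset.range T, effectiveIndepNum (s t ω)) := by
  set X : ℝ := 2 + N + T + 1 / R with hX
  have hNr : (2 : ℝ) ≤ N := by exact_mod_cast hN
  have hX2 : 2 ≤ X := by
    have : 0 < 1 / R := by positivity
    have : (0 : ℝ) ≤ T := by positivity
    linarith
  have hL : 1 / 2 ≤ Real.log X := by
    have := Real.log_le_log (by norm_num) hX2
    linarith [Real.log_two_gt_d9]
  have main : ∀ n ≤ T, (wixState R ℓ s ξ I n ω).cumQ ≤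
      8 * Real.log X * ∑ t ∈ Finset.range n, effectiveIndepNum (s t ω) := by
    intro n hn
    induction n with
    | zero => simp [wixState, Exp3WIX.state]
    | succ n ih =>
      have ih := ih (by omega)
      have hσ := cumQ_nonneg (ℓ := ℓ) (s := s) (ξ := ξ) (I := I) hR hN n ω
      have hγ := Exp3WIX.gamma_pos hR hN hσ
      have h1 : Exp3WIX.Q R (wixState R ℓ s ξ I n ω) (s n ω) ≤
          2 * Real.log (1 + 1 / Exp3WIX.gamma R (wixState R ℓ s ξ I n ω)) *
            effectiveIndepNum (s n ω) :=
        sum_div_sq_weight_le (by omega) (s n ω) (h.graph_self n (by omega) ω)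
          (Exp3WIX.prob R (wixState R ℓ s ξ I n ω)) (Exp3WIX.prob_pos (by omega) _)
          (Exp3WIX.sum_prob (by omega) _) _ hγ
      have h2 : Real.log (1 + 1 / Exp3WIX.gamma R (wixState R ℓ s ξ I n ω)) ≤
          4 * Real.log X := by
        have e : 4 * Real.log X = Real.log (X ^ 4) := by rw [Real.log_pow]; norm_num
        rw [e]
        refine Real.log_le_log (by positivity) ?_
        have h3 := Exp3WIX.inv_gamma_le hR hN hσ (h.cumQ_le hR hN (by omega : n ≤ T) ω)
        rw [← hX] at h3
        have h4 : 1 ≤ X ^ 3 := one_le_pow₀ (by linarith)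
        nlinarith
      have h5 : (wixState R ℓ s ξ I (n + 1) ω).cumQ = (wixState R ℓ s ξ I n ω).cumQ +
        Exp3WIX.Q R (wixState R ℓ s ξ I n ω) (s n ω) := rfl
      rw [h5, Finset.sum_range_succ, mul_add]
      refine add_le_add ih (h1.trans ?_)
      have := effectiveIndepNum_nonneg (s n ω)
      calc _ ≤ 2 * (4 * Real.log X) * effectiveIndepNum (s n ω) := by gcongr
        _ = _ := by ring
  have := main T le_rfl
  nlinarith

lemma integrable_sqrt_effectiveIndepNum [IsProbabilityMeasure P]
    (h : IsNoisyGame P F T R ℓ s ξ I) :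
    Integrable (fun ω =>
      Real.sqrt (N + ∑ t ∈ Finset.range T, effectiveIndepNum (s t ω))) P := by
  refine Integrable.of_bound (Measurable.aestronglyMeasurable ?_) (Real.sqrt (N + T * N))
    (Filter.Eventually.of_forall fun ω => ?_)
  · refine Measurable.sqrt (measurable_const.add (Finset.measurable_sum _ fun t ht => ?_))
    exact measurable_effectiveIndepNum fun i j =>
      (h.graph_meas t (Finset.mem_range.1 ht) i j).mono (F.le t) le_rfl
  · rw [Real.norm_eq_abs, abs_of_nonneg (Real.sqrt_nonneg _)]
    apply Real.sqrt_le_sqrt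
    have := Finset.sum_le_card_nsmul (Finset.range T) (fun t => effectiveIndepNum (s t ω)) N
      fun t _ => effectiveIndepNum_le _
    simp only [Finset.card_range, nsmul_eq_mul] at this
    linarith

/-- The regret bound against a fixed arm, for at least two arms. -/
lemma integral_sum_regret_le [IsProbabilityMeasure P] (h : IsNoisyGame P F T R ℓ s ξ I)
    (hplay : PlaysExp3WIX P F T R ℓ s ξ I) (hR : 0 < R) (hN : 2 ≤ N) (k : Fin N) :
    ∫ ω, (∑ t ∈ Finset.range T, ℓ t ω (I t ω) - ∑ t ∈ Finset.range T, ℓ t ω k) ∂P ≤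
      12 * Real.log (2 + N + T + 1 / R) * (1 + R) *
        ∫ ω, Real.sqrt (N + ∑ t ∈ Finset.range T, effectiveIndepNum (s t ω)) ∂P := by
  have hmem : ∀ {t}, t ∈ Finset.range T → t < T := Finset.mem_range.1
  have hX : ∀ t ∈ Finset.range T, Integrable (wixEstRegret R ℓ s ξ I t k) P := fun t ht =>
    (h.integral_regret_le hplay hR hN (hmem ht) k).1
  have hQ : ∀ t ∈ Finset.range T, Integrable (wixEtaQ R ℓ s ξ I t) P := fun t ht =>
    h.integrable_wixEtaQ hR hN (hmem ht)
  have hsX := integrable_finsetSum _ hX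
  have hsQ := (integrable_finsetSum _ hQ).const_mul (1 + R + R ^ 2)
  have hnoise : ∀ᵐ ω ∂P, ∀ t < T, ∀ i, |ξ t ω i| ≤ R := by
    rw [ae_all_iff]; intro t
    rw [ae_all_iff]; intro ht
    rw [ae_all_iff]; exact h.noise_bound t ht
  calc _ = ∑ t ∈ Finset.range T, ∫ ω, (ℓ t ω (I t ω) - ℓ t ω k) ∂P := by
        simp_rw [← Finset.sum_sub_distrib]
        exact integral_finsetSum _ fun t ht =>
          (h.integrable_arm_loss (hmem ht)).sub (h.integrable_loss (hmem ht) k)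
    _ ≤ ∑ t ∈ Finset.range T, (∫ ω, wixEstRegret R ℓ s ξ I t k ω ∂P +
          (1 + R + R ^ 2) * ∫ ω, wixEtaQ R ℓ s ξ I t ω ∂P) :=
        Finset.sum_le_sum fun t ht => (h.integral_regret_le hplay hR hN (hmem ht) k).2
    _ = ∫ ω, (∑ t ∈ Finset.range T, wixEstRegret R ℓ s ξ I t k ω +
          (1 + R + R ^ 2) * ∑ t ∈ Finset.range T, wixEtaQ R ℓ s ξ I t ω) ∂P := by
        rw [integral_add hsX hsQ, integral_const_mul, integral_finsetSum _ hX,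
          integral_finsetSum _ hQ, Finset.sum_add_distrib, Finset.mul_sum]
    _ ≤ ∫ ω, 12 * Real.log (2 + N + T + 1 / R) * (1 + R) *
          Real.sqrt (N + ∑ t ∈ Finset.range T, effectiveIndepNum (s t ω)) ∂P := by
        refine integral_mono_ae (hsX.add hsQ)
          (h.integrable_sqrt_effectiveIndepNum.const_mul _) ?_
        filter_upwards [hnoise] with ω hω
        have h1 : ∑ t ∈ Finset.range T, wixEstRegret R ℓ s ξ I t k ω ≤
            Real.log N / Exp3WIX.eta R (wixState R ℓ s ξ I T ω) :=
          Exp3WIX.estimated_regret_le hR hN (fun r => s r ω) (fun r => I r ω)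
            (fun r => feedback ℓ s ξ I r ω) T
            (fun t ht i => h.neg_le_weight_mul_feedback hR ht i (hω t ht i)) k
        have h2 : Real.log N / Exp3WIX.eta R (wixState R ℓ s ξ I T ω) +
            (1 + R + R ^ 2) * ∑ t ∈ Finset.range T, wixEtaQ R ℓ s ξ I t ω ≤
            4 * (1 + R) * Real.sqrt (Real.log N) *
              Real.sqrt (N + (wixState R ℓ s ξ I T ω).cumQ) :=
          Exp3WIX.log_div_eta_add_sum_le hR hN (fun r => s r ω) (fun r => I r ω)
            (fun r => feedback ℓ s ξ I r ω) T fun t ht => h.graph_self t ht ω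
        have h3 := h.natCast_add_cumQ_le hR hN ω
        refine (add_le_add_left h1 _).trans (h2.trans ?_)
        set L := Real.log (2 + N + T + 1 / R) with hL
        set A := (N : ℝ) + ∑ t ∈ Finset.range T, effectiveIndepNum (s t ω) with hA
        have hNL : Real.log N ≤ L := by
          refine Real.log_le_log (by positivity) ?_
          have : 0 < 1 / R := by positivity
          have : (0 : ℝ) ≤ T := by positivity
          linarith
        have hL0 : 0 < L := (Exp3WIX.log_natCast_pos hN).trans_le hNL
        have h4 : Real.sqrt (Real.log N) * Real.sqrt (N + (wixState R ℓ s ξ I T ω).cumQ) ≤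
            3 * L * Real.sqrt A := by
          calc _ ≤ Real.sqrt L * Real.sqrt (8 * L * A) := by gcongr
            _ = Real.sqrt (8 * L ^ 2) * Real.sqrt A := by
              rw [← Real.sqrt_mul hL0.le, ← Real.sqrt_mul (by positivity)]
              congr 1; ring
            _ ≤ 3 * L * Real.sqrt A := by
              gcongr
              exact Real.sqrt_le_iff.2 ⟨by positivity, by nlinarith⟩
        calc _ = 4 * (1 + R) *
              (Real.sqrt (Real.log N) * Real.sqrt (N + (wixState R ℓ s ξ I T ω).cumQ)) := by ring
          _ ≤ 4 * (1 + R) * (3 * L * Real.sqrt A) := by gcongr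
          _ = _ := by ring
    _ = _ := integral_const_mul _ _

end IsNoisyGame

end Game

theorem theorem2 :
    ∃ (C : ℝ) (k : ℕ), ∀ (N T : ℕ) (R : ℝ), 0 < R →
      ∀ (Ω : Type*) (m : MeasurableSpace Ω) (P : Measure Ω) (_ : IsProbabilityMeasure P)
        (F : Filtration ℕ m) (ℓ : ℕ → Ω → Fin N → ℝ) (s : ℕ → Ω → Fin N → Fin N → ℝ)
        (ξ : ℕ → Ω → Fin N → ℝ) (I : ℕ → Ω → Fin N),
        IsNoisyGame P F T R ℓ s ξ I →
        PlaysExp3WIX P F T R ℓ s ξ I →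
        expectedRegret P T ℓ I ≤
          C * Real.log (2 + N + T + 1 / R) ^ k * (1 + R) *
            ∫ ω, Real.sqrt (N + ∑ t ∈ Finset.range T, effectiveIndepNum (s t ω)) ∂P := by
  refine ⟨12, 1, fun N T R hR Ω m P _ F ℓ s ξ I h hplay => ?_⟩
  rw [pow_one]
  have hX : 1 ≤ 2 + (N : ℝ) + T + 1 / R := by
    have : 0 < 1 / R := by positivity
    have : (0 : ℝ) ≤ N := by positivity
    have : (0 : ℝ) ≤ T := by positivity
    linarith
  have hrhs : 0 ≤ 12 * Real.log (2 + N + T + 1 / R) * (1 + R) *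
      ∫ ω, Real.sqrt (N + ∑ t ∈ Finset.range T, effectiveIndepNum (s t ω)) ∂P :=
    mul_nonneg (mul_nonneg (mul_nonneg (by norm_num) (Real.log_nonneg hX)) (by linarith))
      (integral_nonneg fun _ => Real.sqrt_nonneg _)
  -- with a single arm there is no choice, and the regret vanishes although `η = 0`
  rcases lt_or_ge N 2 with hN | hN
  · have : Subsingleton (Fin N) := Fin.subsingleton_iff_le_one.2 (by omega)
    refine Real.iSup_le (fun i => ?_) hrhs
    have e : ∀ ω, ∑ t ∈ Finset.range T, ℓ t ω (I t ω) - ∑ t ∈ Finset.range T, ℓ t ω i = 0 :=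
      fun ω => sub_eq_zero.2 (Finset.sum_congr rfl fun t _ => by
        rw [Subsingleton.elim (I t ω) i])
    simpa [e] using hrhs
  · exact Real.iSup_le (fun i => h.integral_sum_regret_le hplay hR hN i) hrhs
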